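/- **Setting.** Let $k\ge 1$, let $\mathcal H_1,\dots,\mathcal H_k,\mathcal K_1,\dots,\mathcal K_k$ be finite-dimensional complex Hilbert spaces, $\psi\in\mathcal H_1\otimes\dots\otimes\mathcal H_k$ and $\varphi\in\mathcal K_1\otimes\dots\otimes\mathcal K_k$ unit vectors, and $A_j\in\mathbb C[z,z^{-1}]\otimes\mathrm{Hom}(\mathcal H_j,\mathcal K_j)$ linear-map-valued Laurent polynomials forming a degeneration of error degree (at most) $e\in\mathbb N$: $$(A_1(z)\otimes\dots\otimes A_k(z))\psi=\sum_{h=0}^e z^h\varphi_h,\qquad \varphi_0=\varphi .$$ Write $A(z)=A_1(z)\otimes\dots\otimes A_k(z)$, let $\|\cdot\|$ be the operator norm and $\log=\log_2$. *Protocols.* A protocol for $n$ copies with $t$ points consists of $z_i\in\mathbb C\setminus\{0\}$, $c_i\in\mathbb C$, $\gamma_{j,i}\in\mathbb C\setminus\{0\}$ ($1\le i\le t$, $1\le j\le k$) with $\sum_i z_i^hc_i=\delta_{h,0}$ for $0\le h\le ne$ and $\big\|\sum_i|\gamma_{j,i}|^2A_j(z_i)^{\otimes n}(A_j(z_i)^{\otimes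 n})^*\big\|\le1$ for all $j$. Its success probability (a lower bound on the probability of transforming $\mathrm{GHZ}_t\otimes\psi^{\otimes n}$ into $\varphi^{\otimes n}$ by LOCC) is $\big(\sum_i|c_i|^2/|g_i|^2\big)^{-1}$, where $g_i=\prod_j\gamma_{j,i}$. A number $r\ge0$ is an *achievable error exponent* if $r=-\liminf_{n\to\infty}\frac1n\log p_n$ where, for each $n$, $p_n$ is the success probability of some protocol for $n$ copies with $t_n$ points, and $\frac1n\log t_n\to0$. The *optimal exponent* $r_{\mathrm{opt}}$ is the infimum of the achievable error exponents. *Single-letter expression.* Put $$F=2\inf_{\sigma}\ \sup_{z\in\operatorname{supp}\sigma}\Big[\log\|A(z)\|+e\int_{\mathbb C}\log\frac{|t|}{|z-t|}\,\mathrm d\sigma(t)\Big],$$ the infimum being over the Borel probability measures $\sigma$ on $\mathbb C$ with $0\notin\operatorname{supp}\sigma$ (so that the integral is well defined in $(-\infty,+\infty]$); the bracket is read as $+\infty$ whenever the integral is $+\infty$. **Statement.** For every $R>0$ the function $\varphi\mapsto\log\|A(Re^{i\varphi})\|$ is integrable on $[0,2\pi]$ and $$r_{\mathrm{opt}}\le\frac{2}{2\pi}\int_0^{2\pi}\log\|A_1(Re^{i\varphi})\otimes\dots\otimes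 A_k(Re^{i\varphi})\|\,\mathrm d\varphi,\qquad F\le\frac{2}{2\pi}\int_0^{2\pi}\log\|A_1(Re^{i\varphi})\otimes\dots\otimes A_k(Re^{i\varphi})\|\,\mathrm d\varphi .$$ Consequently $$r=2\inf_{R>0}\frac1{2\pi}\int_0^{2\pi}\log\|A_1(Re^{i\varphi})\otimes\dots\otimes A_k(Re^{i\varphi})\|\,\mathrm d\varphi$$ is finite and is an achievable error exponent. Also operationally: there are $t_n=2^{o(n)}$ and $p_n>0$ with $r=-\liminf_{n\to\infty}\frac1n\log p_n$ such that for every $n$ some finite-round LOCC protocol transforms $\mathrm{GHZ}_{t_n}\otimes\psi^{\otimes n}$ into $\varphi^{\otimes n}$ with probability $p_n$. -/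

import Mathlib

open Filter Topology MeasureTheory
open scoped Matrix Matrix.Norms.L2Operator ENNReal ComplexOrder

noncomputable section

namespace Degeneration

/-- Vectors of `⨂ⱼ ℂ^(ι j)`, given by their coordinates in the product basis. -/
abbrev State {k : ℕ} (ι : Fin k → Type) : Type := (∀ j, ι j) → ℂ

/-- The vector has Euclidean norm one. -/
def IsUnitVector {k : ℕ} {ι : Fin k → Type} [∀ j, Fintype (ι j)] (ψ : State ι) : Prop :=
  ∑ x, ‖ψ x‖ ^ 2 = 1

/-- The matrix of `M₁ ⊗ ⋯ ⊗ M_k` in the product bases. -/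
def tensorMatrix {k : ℕ} {ι κ : Fin k → Type} (M : ∀ j, Matrix (κ j) (ι j) ℂ) :
    Matrix (∀ j, κ j) (∀ j, ι j) ℂ :=
  Matrix.of fun x y => ∏ j, M j (x j) (y j)

/-- The matrix of `M^{⊗ n}` in the product bases. -/
def powMatrix {ι κ : Type} (n : ℕ) (M : Matrix κ ι ℂ) : Matrix (Fin n → κ) (Fin n → ι) ℂ :=
  Matrix.of fun x y => ∏ m, M (x m) (y m)

/-- Linear-map-valued Laurent polynomials, i.e. `ℂ[z, z⁻¹] ⊗ Hom(ℂ^ι, ℂ^κ)`: finitely many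
coefficients indexed by the exponents in `ℤ`. -/
abbrev LaurentMap (κ ι : Type) : Type := ℤ →₀ Matrix κ ι ℂ

/-- The value of a Laurent polynomial at `z` (meant for `z ≠ 0` only). -/
def LaurentMap.eval {κ ι : Type} (A : LaurentMap κ ι) (z : ℂ) : Matrix κ ι ℂ :=
  A.sum fun m M => z ^ m • M

section Parties

variable {k : ℕ} {ι κ : Fin k → Type}
variable [∀ j, Fintype (ι j)] [∀ j, DecidableEq (ι j)]
variable [∀ j, Fintype (κ j)] [∀ j, DecidableEq (κ j)]

/-- `(A₁(z) ⊗ ⋯ ⊗ A_k(z)) ψ = φ + z φ₁ + ⋯ + z^e φ_e`, with `ψ` and `φ` unit vectors. -/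
structure IsDegeneration (A : ∀ j, LaurentMap (κ j) (ι j)) (ψ : State ι) (φ : State κ)
    (e : ℕ) : Prop where
  unit_source : IsUnitVector ψ
  unit_target : IsUnitVector φ
  expansion : ∃ Φ : ℕ → State κ, Φ 0 = φ ∧ ∀ z : ℂ, z ≠ 0 →
    tensorMatrix (fun j => (A j).eval z) *ᵥ ψ = ∑ h ∈ Finset.range (e + 1), z ^ h • Φ h

/-- The operator norm `‖A₁(z) ⊗ ⋯ ⊗ A_k(z)‖` between the Euclidean spaces. -/
def normA (A : ∀ j, LaurentMap (κ j) (ι j)) (z : ℂ) : ℝ :=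
  ‖tensorMatrix (fun j => (A j).eval z)‖

/-- `log₂ ‖A₁(z) ⊗ ⋯ ⊗ A_k(z)‖` as a real number. -/
def logNormA (A : ∀ j, LaurentMap (κ j) (ι j)) (z : ℂ) : ℝ := Real.logb 2 (normA A z)

/-! ### The interpolation protocols and their exponents -/

/-- The parameters of the protocol for `n` copies with `t` interpolation points. The matrix in
`contraction` is `Ãⱼ Ãⱼ*` for `Ãⱼ = ∑ᵢ γⱼᵢ ⟨i| ⊗ Aⱼ(zᵢ)^{⊗ n}`. -/
structure Protocol (A : ∀ j, LaurentMap (κ j) (ι j)) (e n t : ℕ) where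
  z : Fin t → ℂ
  c : Fin t → ℂ
  γ : Fin k → Fin t → ℂ
  z_ne_zero : ∀ i, z i ≠ 0
  γ_ne_zero : ∀ j i, γ j i ≠ 0
  interpolation : ∀ h ≤ n * e, ∑ i, z i ^ h * c i = if h = 0 then 1 else 0
  contraction : ∀ j, ‖∑ i, ((‖γ j i‖ ^ 2 : ℝ) : ℂ) •
    (powMatrix n ((A j).eval (z i)) * (powMatrix n ((A j).eval (z i)))ᴴ)‖ ≤ 1

/-- The success probability `(∑ᵢ |cᵢ|² / |gᵢ|²)⁻¹` with `gᵢ = ∏ⱼ γⱼᵢ`. -/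
def Protocol.successProb {A : ∀ j, LaurentMap (κ j) (ι j)} {e n t : ℕ}
    (P : Protocol A e n t) : ℝ :=
  (∑ i, ‖P.c i‖ ^ 2 / ‖∏ j, P.γ j i‖ ^ 2)⁻¹

/-- `t n = 2^{o(n)}`. -/
def Subexponential (t : ℕ → ℕ) : Prop :=
  Tendsto (fun n : ℕ => Real.logb 2 (t n) / n) atTop (𝓝 0)

/-- `r = - liminf (1/n) log₂ pₙ`. -/
def HasExponent (p : ℕ → ℝ) (r : ℝ) : Prop :=
  (r : EReal) = - liminf (fun n : ℕ => ((Real.logb 2 (p n) / n : ℝ) : EReal)) atTop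

/-- `r ≥ 0` is the error exponent of some sequence of protocols, the number of interpolation
points being subexponential. -/
def IsAchievableExponent (A : ∀ j, LaurentMap (κ j) (ι j)) (e : ℕ) (r : ℝ) : Prop :=
  0 ≤ r ∧ ∃ t : ℕ → ℕ, Subexponential t ∧ ∃ P : ∀ n, Protocol A e n (t n),
    HasExponent (fun n => (P n).successProb) r

/-- The optimal (smallest) error exponent of the protocols. -/
def optimalExponent (A : ∀ j, LaurentMap (κ j) (ι j)) (e : ℕ) : ℝ :=
  sInf {r : ℝ | IsAchievableExponent A e r}

/-! ### LOCC transformations -/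

/-- `LOCCReaches φ Ψ p`: some LOCC protocol with finitely many rounds turns `Ψ` into `φ` with
success probability `p`. The intermediate vectors are kept unnormalized, so that their squared
norms are the probabilities of the branches. In a round every party `j` performs a local measurement
with Kraus operators `M j a`, `∑ₐ (M j a)* (M j a) ≤ 1` (outcomes left out count as
failures), and announces the outcome; the rest of the protocol may depend on all outcomes. -/
inductive LOCCReaches (φ : State κ) : ∀ {ι : Fin k → Type} [∀ j, Fintype (ι j)]
    [∀ j, DecidableEq (ι j)], State ι → ℝ → Prop
  | accept (c : ℂ) : LOCCReaches φ (c • φ) (‖c‖ ^ 2)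
  | reject {ι : Fin k → Type} [∀ j, Fintype (ι j)] [∀ j, DecidableEq (ι j)] (Ψ : State ι) :
      LOCCReaches φ Ψ 0
  | round {ι ι' : Fin k → Type} [∀ j, Fintype (ι j)] [∀ j, DecidableEq (ι j)]
      [∀ j, Fintype (ι' j)] [∀ j, DecidableEq (ι' j)]
      (Ψ : State ι) {Ω : Fin k → Type} [∀ j, Fintype (Ω j)]
      (M : ∀ j, Ω j → Matrix (ι' j) (ι j) ℂ)
      (hM : ∀ j, (1 - ∑ a, (M j a)ᴴ * M j a).PosSemidef)
      (p : (∀ j, Ω j) → ℝ)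
      (h : ∀ a, LOCCReaches φ (tensorMatrix (fun j => M j (a j)) *ᵥ Ψ) (p a)) :
      LOCCReaches φ Ψ (∑ a, p a)

/-- The vector `ψ^{⊗ n}`, the `n` subsystems of each party being grouped together. -/
def statePow (n : ℕ) (ψ : State ι) : State (fun j => Fin n → ι j) :=
  fun x => ∏ m, ψ fun j => x j m

/-- The tensor product of two `k`-partite vectors, as a `k`-partite vector. -/
def stateProd (ψ : State ι) (χ : State κ) : State (fun j => ι j × κ j) :=
  fun x => ψ (fun j => (x j).1) * χ (fun j => (x j).2)

open Classical in
/-- The `t`-level GHZ state `t^{-1/2} ∑ᵢ |i⟩ ⊗ ⋯ ⊗ |i⟩`. -/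
def ghz (k t : ℕ) : State (fun _ : Fin k => Fin t) :=
  fun x => if ∃ i, ∀ j, x j = i then ((Real.sqrt t)⁻¹ : ℝ) else 0

/-- `ψ^{⊗ n}`, together with a GHZ state of `2^{o(n)}` levels, can be transformed by LOCC into
`φ^{⊗ n}` with probabilities `pₙ` satisfying `r = - liminf (1/n) log₂ pₙ`. -/
def IsLOCCAchievableExponent (ψ : State ι) (φ : State κ) (r : ℝ) : Prop :=
  0 ≤ r ∧ ∃ t : ℕ → ℕ, Subexponential t ∧ ∃ p : ℕ → ℝ,
    (∀ n, 0 < p n ∧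
      LOCCReaches (statePow n φ) (stateProd (ghz k (t n)) (statePow n ψ)) (p n)) ∧
    HasExponent p r

/-! ### The single-letter formula -/

/-- The base-2 logarithm with `log₂ 0 = -∞` and `log₂ ∞ = ∞`. -/
def elog2 (x : ℝ≥0∞) : EReal := ENNReal.log x / ((Real.log 2 : ℝ) : EReal)

/-- The potential `∫ log₂ (|t| / |z - t|) dσ(t)`, as the integral of the positive part minus the
integral of the negative part. If `0` is not in the support of `σ` then the latter is finite. -/
def potential (σ : Measure ℂ) (z : ℂ) : EReal :=
  ((∫⁻ t, (elog2 (‖t‖ₑ / ‖z - t‖ₑ)).toENNReal ∂σ : ℝ≥0∞) : EReal) -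
    ((∫⁻ t, (- elog2 (‖t‖ₑ / ‖z - t‖ₑ)).toENNReal ∂σ : ℝ≥0∞) : EReal)

open Classical in
/-- `log₂ ‖A₁(z) ⊗ ⋯ ⊗ A_k(z)‖ + e ∫ log₂ (|t| / |z - t|) dσ(t)`, read as `+∞` whenever the
integral is `+∞` (also if the first term is `-∞`). -/
def objective (A : ∀ j, LaurentMap (κ j) (ι j)) (e : ℕ) (σ : Measure ℂ) (z : ℂ) : EReal :=
  if potential σ z = ⊤ then ⊤
  else elog2 (ENNReal.ofReal (normA A z)) + (e : EReal) * potential σ z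

/-- `2 inf_σ sup_{z ∈ supp σ} [log₂ ‖A₁(z) ⊗ ⋯ ⊗ A_k(z)‖ + e ∫ log₂ (|t| / |z - t|) dσ(t)]`.
Only `σ` with `0 ∉ supp σ` are admitted: `A₁(z) ⊗ ⋯ ⊗ A_k(z)` has its pole at `0`. -/
def exponentFormula (A : ∀ j, LaurentMap (κ j) (ι j)) (e : ℕ) : EReal :=
  2 * ⨅ σ : {σ : ProbabilityMeasure ℂ // (0 : ℂ) ∉ (σ : Measure ℂ).support},
    ⨆ z ∈ (σ.1 : Measure ℂ).support, objective A e (σ.1 : Measure ℂ) z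

end Parties

end Degeneration

end

noncomputable section

namespace Degeneration

/-! ### Operator norms of matrices -/

section OperatorNorm

variable {m n : Type} [Fintype m] [Fintype n] [DecidableEq n]

/-! Interpolate at `N = n * e + 1` nodes on the circle of radius `R`, with `c i` the Lagrange basis
polynomials at `0`, so that `|c i| = ∏_{j ≠ i} R / |z i - z j|`. Let `w = ∏ⱼ (‖Aⱼ‖ + δ)`, and let
`L` be the circle average of `log w`. Choosing `γ j i` inversely proportional to `(‖Aⱼ(z i)‖ + δ) ^
n` reduces everything to bounding `|c i| * w (z i) ^ n`. Take weighted Fekete points: each node then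
maximises `y ↦ ∏_{j ≠ i} |y - z j| / w y ^ n` on the circle, so the logarithm of the maximum is at
least its circle average. As `log |y - z j|` averages to `log R`, this says exactly `|c i| * w (z i)
^ n ≤ exp (n * L)` (`exists_nodes_circle`, `exists_nodes_protocol`). The remaining losses are powers
of `N`.

Letting `δ → 0` requires control of `log ‖A(z)‖` near zeros of `A`. The overlap `⟨φ, A(z) ψ⟩` is a
polynomial with value `1` at `0` and is dominated by `‖A(z)‖`. This gives integrability and
dominated convergence, and Jensen's formula makes the averages nonnegative. Since `R` and `δ` may
depend on `n`, the infimum over `R` is itself achievable.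

The single-letter bound uses the same extremal principle with the truncated kernel `max (|a - b| -
ρ) ρ ^ e`, where the power applies to the whole maximum. The nodes are smeared to circles of radius
`ρ`, whose potentials are explicit and finite (`exists_nodes_formula`, `potential_nodeMeasure`).

Operationally, a measurement turns the GHZ state into one with amplitudes proportional to `c i / g
i`; local contractions followed by interpolation then produce the target (`Protocol.loccReaches`).
-/

lemma sum_sq_mulVec_le (M : Matrix m n ℂ) (v : n → ℂ) :
    ∑ x, ‖(M *ᵥ v) x‖ ^ 2 ≤ ‖M‖ ^ 2 * ∑ y, ‖v y‖ ^ 2 := by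
  have h := M.l2_opNorm_mulVec (WithLp.toLp 2 v)
  have h2 := pow_le_pow_left₀ (norm_nonneg _) h 2
  rw [mul_pow, EuclideanSpace.norm_sq_eq, EuclideanSpace.norm_sq_eq] at h2
  simpa using h2

lemma norm_le_of_sum_sq_mulVec_le (M : Matrix m n ℂ) {C : ℝ} (hC : 0 ≤ C)
    (h : ∀ v : n → ℂ, ∑ x, ‖(M *ᵥ v) x‖ ^ 2 ≤ C ^ 2 * ∑ y, ‖v y‖ ^ 2) : ‖M‖ ≤ C := by
  rw [Matrix.l2_opNorm_def]
  refine ContinuousLinearMap.opNorm_le_bound _ hC fun v => ?_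
  refine le_of_sq_le_sq ?_ (by positivity)
  rw [mul_pow, EuclideanSpace.norm_sq_eq, EuclideanSpace.norm_sq_eq]
  exact h v

/-- Compactness of the finite-dimensional closed ball. The bound `≤ 1` replaces `= 1` because an
empty `n` has no unit vector. -/
lemma exists_norm_sq_le_sum_sq_mulVec (M : Matrix m n ℂ) :
    ∃ v : n → ℂ, ∑ y, ‖v y‖ ^ 2 ≤ 1 ∧ ‖M‖ ^ 2 ≤ ∑ x, ‖(M *ᵥ v) x‖ ^ 2 := by
  set f := (Matrix.toEuclideanLin (𝕜 := ℂ) (m := m) (n := n)).trans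
    LinearMap.toContinuousLinearMap M with hf
  obtain ⟨x, hx, hmax⟩ := (isCompact_closedBall (0 : EuclideanSpace ℂ n) 1).exists_isMaxOn
    ⟨0, by simp⟩ (f := fun x => ‖f x‖) (by fun_prop)
  have hle : ‖M‖ ≤ ‖f x‖ := by
    rw [Matrix.l2_opNorm_def, ← hf]
    refine ContinuousLinearMap.opNorm_le_of_unit_norm (𝕜 := ℂ) (norm_nonneg _) fun y hy => ?_
    exact hmax (by simp [hy])
  refine ⟨x, ?_, ?_⟩
  · rw [← EuclideanSpace.norm_sq_eq]
    exact pow_le_one₀ (norm_nonneg _) (by simpa using hx)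
  · refine (pow_le_pow_left₀ (norm_nonneg _) hle 2).trans_eq ?_
    rw [EuclideanSpace.norm_sq_eq]
    rfl

lemma posSemidef_one_sub_conjTranspose_mul_self (M : Matrix m n ℂ) (hM : ‖M‖ ≤ 1) :
    (1 - Mᴴ * M).PosSemidef := by
  refine Matrix.PosSemidef.of_dotProduct_mulVec_nonneg ?_ fun v => ?_
  · exact Matrix.isHermitian_one.sub (Matrix.isHermitian_conjTranspose_mul_self M)
  · have h := sum_sq_mulVec_le M v
    have h1 : ‖M‖ ^ 2 * ∑ y, ‖v y‖ ^ 2 ≤ ∑ y, ‖v y‖ ^ 2 :=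
      mul_le_of_le_one_left (by positivity) (pow_le_one₀ (norm_nonneg _) hM)
    have key (l : Type) [Fintype l] (u : l → ℂ) : star u ⬝ᵥ u = ((∑ y, ‖u y‖ ^ 2 : ℝ) : ℂ) := by
      simp [dotProduct, Complex.conj_mul']
    rw [Matrix.sub_mulVec, dotProduct_sub, Matrix.one_mulVec, ← Matrix.mulVec_mulVec,
      Matrix.dotProduct_mulVec, ← Matrix.star_mulVec, key, key, ← Complex.ofReal_sub]
    exact_mod_cast sub_nonneg.2 (h.trans h1)

end OperatorNorm

/-! ### Tensor products of matrices -/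

section Tensor

lemma tensorMatrix_mul {k : ℕ} {ι κ μ : Fin k → Type} [∀ j, Fintype (ι j)] [∀ j, Fintype (κ j)]
    (M : ∀ j, Matrix (μ j) (κ j) ℂ) (N : ∀ j, Matrix (κ j) (ι j) ℂ) :
    tensorMatrix M * tensorMatrix N = tensorMatrix fun j => M j * N j := by
  ext x y
  simp only [tensorMatrix, Matrix.mul_apply, Matrix.of_apply, ← Finset.prod_mul_distrib]
  rw [Finset.prod_univ_sum]
  simp

lemma tensorMatrix_mulVec_prod {k : ℕ} {ι κ : Fin k → Type} [∀ j, Fintype (ι j)]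
    (M : ∀ j, Matrix (κ j) (ι j) ℂ) (v : ∀ j, ι j → ℂ) (x : ∀ j, κ j) :
    (tensorMatrix M *ᵥ fun y => ∏ j, v j (y j)) x = ∏ j, (M j *ᵥ v j) (x j) := by
  simp only [tensorMatrix, Matrix.mulVec, dotProduct, Matrix.of_apply, ← Finset.prod_mul_distrib]
  rw [Finset.prod_univ_sum]
  simp

lemma sum_cons {k : ℕ} {ι : Fin (k + 1) → Type} [∀ j, Fintype (ι j)]
    {E : Type*} [AddCommMonoid E] (f : (∀ j, ι j) → E) :
    ∑ x, f x = ∑ a, ∑ y : ∀ j : Fin k, ι j.succ, f (Fin.cons a y) := by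
  rw [← (Fin.consEquiv ι).sum_comp, Fintype.sum_prod_type]
  rfl

/-- Peel off the first factor: the tail acts on the slices of `v` with fixed first coordinate, then
`M 0` acts on the first coordinate. -/
lemma norm_tensorMatrix_le : ∀ {k : ℕ} {ι κ : Fin k → Type} [∀ j, Fintype (ι j)]
    [∀ j, DecidableEq (ι j)] [∀ j, Fintype (κ j)]
    (M : ∀ j, Matrix (κ j) (ι j) ℂ), ‖tensorMatrix M‖ ≤ ∏ j, ‖M j‖ := by
  intro k
  induction k with
  | zero =>
    intro ι κ _ _ _ M
    refine norm_le_of_sum_sq_mulVec_le _ (by simp) fun v => ?_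
    simp [tensorMatrix, Matrix.mulVec, dotProduct]
  | succ k ih =>
    intro ι κ _ _ _ M
    refine norm_le_of_sum_sq_mulVec_le _ (by positivity) fun v => ?_
    set M' : ∀ j : Fin k, Matrix (κ j.succ) (ι j.succ) ℂ := fun j => M j.succ with hM'
    set u : ι 0 → (∀ j : Fin k, κ j.succ) → ℂ :=
      fun a => tensorMatrix M' *ᵥ fun y => v (Fin.cons a y) with hu
    have hentry (a : κ 0) (x : ∀ j : Fin k, κ j.succ) :
        (tensorMatrix M *ᵥ v) (Fin.cons a x) = (M 0 *ᵥ fun b => u b x) a := by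
      simp only [hu, Matrix.mulVec, dotProduct, tensorMatrix, Matrix.of_apply, sum_cons,
        Fin.prod_univ_succ, Fin.cons_zero, Fin.cons_succ, Finset.mul_sum, hM', mul_assoc]
    have hu_le (b : ι 0) : ∑ x, ‖u b x‖ ^ 2 ≤
        (∏ j, ‖M' j‖) ^ 2 * ∑ y : ∀ j : Fin k, ι j.succ, ‖v (Fin.cons b y)‖ ^ 2 :=
      (sum_sq_mulVec_le _ _).trans (by gcongr; exact ih M')
    calc ∑ x, ‖(tensorMatrix M *ᵥ v) x‖ ^ 2
        = ∑ x : ∀ j : Fin k, κ j.succ, ∑ a, ‖(M 0 *ᵥ fun b => u b x) a‖ ^ 2 := by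
          rw [sum_cons, Finset.sum_comm]
          simp only [hentry]
      _ ≤ ∑ x : ∀ j : Fin k, κ j.succ, ‖M 0‖ ^ 2 * ∑ b, ‖u b x‖ ^ 2 :=
          Finset.sum_le_sum fun x _ => sum_sq_mulVec_le _ _
      _ = ‖M 0‖ ^ 2 * ∑ b, ∑ x, ‖u b x‖ ^ 2 := by rw [← Finset.mul_sum, Finset.sum_comm]
      _ ≤ ‖M 0‖ ^ 2 * ∑ b, (∏ j, ‖M' j‖) ^ 2 *
            ∑ y : ∀ j : Fin k, ι j.succ, ‖v (Fin.cons b y)‖ ^ 2 := by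
          gcongr with b; exact hu_le b
      _ = (∏ j, ‖M j‖) ^ 2 * ∑ y, ‖v y‖ ^ 2 := by
          rw [← Finset.mul_sum, ← sum_cons (fun y => ‖v y‖ ^ 2), Fin.prod_univ_succ]
          ring

/-- The lower bound comes from testing on the product of norm-attaining vectors of the factors. -/
lemma norm_tensorMatrix {k : ℕ} {ι κ : Fin k → Type} [∀ j, Fintype (ι j)]
    [∀ j, DecidableEq (ι j)] [∀ j, Fintype (κ j)]
    (M : ∀ j, Matrix (κ j) (ι j) ℂ) : ‖tensorMatrix M‖ = ∏ j, ‖M j‖ := by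
  refine le_antisymm (norm_tensorMatrix_le M) ?_
  choose v hv hMv using fun j => exists_norm_sq_le_sum_sq_mulVec (M j)
  refine le_of_sq_le_sq ?_ (norm_nonneg _)
  have hprod (l : Fin k → Type) [∀ j, Fintype (l j)]
      (u : ∀ j, l j → ℂ) :
      ∑ x : ∀ j, l j, ‖∏ j, u j (x j)‖ ^ 2 = ∏ j, ∑ a, ‖u j a‖ ^ 2 := by
    simp only [norm_prod, ← Finset.prod_pow]
    rw [Finset.prod_univ_sum]
    simp
  calc (∏ j, ‖M j‖) ^ 2 ≤ ∏ j, ∑ x, ‖(M j *ᵥ v j) x‖ ^ 2 := by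
        rw [← Finset.prod_pow]
        exact Finset.prod_le_prod (fun _ _ => by positivity) fun j _ => hMv j
    _ = ∑ x, ‖(tensorMatrix M *ᵥ fun y => ∏ j, v j (y j)) x‖ ^ 2 := by
        simp only [tensorMatrix_mulVec_prod]
        exact (hprod _ _).symm
    _ ≤ ‖tensorMatrix M‖ ^ 2 * ∑ y : ∀ j, ι j, ‖∏ j, v j (y j)‖ ^ 2 := sum_sq_mulVec_le _ _
    _ ≤ ‖tensorMatrix M‖ ^ 2 := by
        rw [hprod]
        exact mul_le_of_le_one_right (by positivity)
          (Finset.prod_le_one (fun _ _ => by positivity) fun j _ => hv j)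

lemma norm_powMatrix_le {ι κ : Type} [Fintype ι] [DecidableEq ι] [Fintype κ]
    (n : ℕ) (M : Matrix κ ι ℂ) : ‖powMatrix n M‖ ≤ ‖M‖ ^ n := by
  exact (norm_tensorMatrix_le fun _ : Fin n => M).trans_eq (by simp)

end Tensor

/-! ### Averages over circles -/

section CircleAverage

open Real Metric

lemma ae_circleMap_notMem_of_countable {s : Set ℂ} (hs : s.Countable) (c : ℂ) {R : ℝ}
    (hR : R ≠ 0) : ∀ᵐ θ : ℝ, circleMap c R θ ∉ s := by
  exact measure_eq_zero_iff_ae_notMem.1 ((hs.preimage_circleMap c hR).measure_zero volume)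

lemma circleAverage_mono_of_countable {f g : ℂ → ℝ} {c : ℂ} {R : ℝ} (hR : R ≠ 0)
    (hf : CircleIntegrable f c R) (hg : CircleIntegrable g c R) {s : Set ℂ} (hs : s.Countable)
    (h : ∀ z ∈ sphere c |R|, z ∉ s → f z ≤ g z) :
    circleAverage f c R ≤ circleAverage g c R := by
  unfold circleAverage
  refine smul_le_smul_of_nonneg_left ?_ (by positivity)
  refine intervalIntegral.integral_mono_ae two_pi_pos.le hf hg ?_
  filter_upwards [ae_circleMap_notMem_of_countable hs c hR] with θ hθ
  exact h _ (circleMap_mem_sphere' c R θ) hθ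

/-- Dominated convergence for the averages of logarithms. -/
lemma tendsto_circleAverage_log {f : ℂ → ℝ} {w : ℕ → ℂ → ℝ} {a : ℂ} {R c C : ℝ} (hR : R ≠ 0)
    (hc : 0 < c) (hf : CircleIntegrable (fun z => log (f z)) a R)
    (hf0 : ∀ z ∈ sphere a |R|, 0 ≤ f z) {s : Set ℂ} (hs : s.Countable)
    (hfs : ∀ z ∈ sphere a |R|, z ∉ s → f z ≠ 0)
    (hw : ∀ m, ContinuousOn (w m) (sphere a |R|))
    (hlow : ∀ m, ∀ z ∈ sphere a |R|, c * f z ≤ w m z)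
    (hup : ∀ m, ∀ z ∈ sphere a |R|, w m z ≤ C)
    (hlim : ∀ z ∈ sphere a |R|, Tendsto (fun m => w m z) atTop (𝓝 (f z))) :
    Tendsto (fun m => circleAverage (fun z => log (w m z)) a R) atTop
      (𝓝 (circleAverage (fun z => log (f z)) a R)) := by
  unfold circleAverage
  refine Tendsto.const_smul ?_ _
  have hmem := circleMap_mem_sphere' a R
  have hae := ae_circleMap_notMem_of_countable hs a hR
  -- Off the exceptional set, `log c + log f ≤ log w ≤ log C`; the majorant absorbs both sides.
  refine intervalIntegral.tendsto_integral_filter_of_dominated_convergence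
    (fun θ => |log c| + |log C| + |log (f (circleMap a R θ))|) ?_ ?_ ?_ ?_
  · refine Eventually.of_forall fun m => ?_
    have : Continuous fun θ => w m (circleMap a R θ) :=
      (hw m).comp_continuous (continuous_circleMap a R) hmem
    exact (measurable_log.comp this.measurable).aestronglyMeasurable
  · refine Eventually.of_forall fun m => ?_
    filter_upwards [hae] with θ hθ _
    have hfpos : 0 < f (circleMap a R θ) :=
      lt_of_le_of_ne (hf0 _ (hmem θ)) (hfs _ (hmem θ) hθ).symm
    have h1 := hlow m _ (hmem θ)
    have h2 := hup m _ (hmem θ)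
    have hwpos := (mul_pos hc hfpos).trans_le h1
    have h3 := log_le_log (mul_pos hc hfpos) h1
    have h4 := log_le_log hwpos h2
    rw [log_mul hc.ne' hfpos.ne'] at h3
    rw [norm_eq_abs, abs_le]
    constructor
    · linarith [neg_abs_le (log c), abs_nonneg (log C), neg_abs_le (log (f (circleMap a R θ)))]
    · linarith [le_abs_self (log C), abs_nonneg (log c), abs_nonneg (log (f (circleMap a R θ)))]
  · exact intervalIntegrable_const.add (IntervalIntegrable.abs hf)
  · filter_upwards [hae] with θ hθ _
    exact (hlim _ (hmem θ)).log (hfs _ (hmem θ) hθ)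

/-- Rotation invariance, used to make estimates uniform in `t`. -/
lemma circleAverage_norm_sub_eq_of_norm_eq {R : ℝ} (g : ℝ → ℝ) {t : ℂ}
    (ht : ‖t‖ = R) :
    circleAverage (fun y => g ‖y - t‖) 0 R = circleAverage (fun y => g ‖y - R‖) 0 R := by
  rw [circleAverage_eq_integral_add (f := fun y => g ‖y - t‖) t.arg, circleAverage]
  congr 3 with θ
  congr 1
  have h1 : circleMap 0 R (θ + t.arg) - t =
      (circleMap 0 R θ - R) * Complex.exp (t.arg * Complex.I) := by
    nth_rw 2 [← Complex.norm_mul_exp_arg_mul_I t]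
    rw [ht]
    simp only [circleMap, zero_add, Complex.ofReal_add, add_mul, Complex.exp_add]
    ring
  rw [h1, norm_mul, Complex.norm_exp_ofReal_mul_I, mul_one]

end CircleAverage

/-! ### Extremal nodes -/

section Nodes

open Finset in
/-- Maximisers of `∏_{i ≠ j} K (x i) (x j) * ∏ i, W (x i) ^ 2` over `N`-tuples of a compact space:
each point maximises its own factor, the others being fixed. -/
lemma exists_extremal_nodes {X : Type*} [TopologicalSpace X] [CompactSpace X] {N : ℕ}
    {K : X → X → ℝ} {W : X → ℝ} (hK : Continuous fun p : X × X => K p.1 p.2)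
    (hKsymm : ∀ a b, K a b = K b a) (hK0 : ∀ a b, 0 ≤ K a b) (hW : Continuous W)
    (hW0 : ∀ a, 0 < W a) (x₀ : Fin N → X) (hx₀ : ∀ i j, i ≠ j → 0 < K (x₀ i) (x₀ j)) :
    ∃ x : Fin N → X, (∀ i j, i ≠ j → 0 < K (x i) (x j)) ∧
      ∀ i y, (∏ j ∈ univ.erase i, K y (x j)) * W y ≤
        (∏ j ∈ univ.erase i, K (x i) (x j)) * W (x i) := by
  set Φ : (Fin N → X) → ℝ := fun x =>
    (∏ i, ∏ j ∈ univ.erase i, K (x i) (x j)) * (∏ i, W (x i)) ^ 2 with hΦ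
  have hΦc : Continuous Φ := by
    refine Continuous.mul ?_ (by fun_prop)
    refine continuous_finsetProd _ fun i _ => continuous_finsetProd _ fun j _ => ?_
    exact hK.comp (by fun_prop : Continuous fun x : Fin N → X => (x i, x j))
  obtain ⟨x, -, hx⟩ := isCompact_univ.exists_isMaxOn ⟨x₀, Set.mem_univ _⟩ hΦc.continuousOn
  have hpos : 0 < Φ x := by
    refine lt_of_lt_of_le ?_ (hx (Set.mem_univ x₀))
    refine mul_pos (prod_pos fun i _ => prod_pos fun j hj => hx₀ i j ?_)
      (pow_pos (prod_pos fun i _ => hW0 _) 2)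
    exact (ne_of_mem_erase hj).symm
  have hKpos (i j) (hij : i ≠ j) : 0 < K (x i) (x j) := by
    refine lt_of_le_of_ne (hK0 _ _) fun h0 => hpos.ne' ?_
    have : ∏ i, ∏ j ∈ univ.erase i, K (x i) (x j) = 0 :=
      prod_eq_zero (mem_univ i) (prod_eq_zero (mem_erase.2 ⟨hij.symm, mem_univ j⟩) h0.symm)
    simp [hΦ, this]
  refine ⟨x, hKpos, fun i y => ?_⟩
  -- All factors of `Φ` not involving the `i`-th point. By symmetry of `K`, each factor that
  -- involves it occurs twice, which is why `W` enters `Φ` squared.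
  set rest : ℝ := (∏ a ∈ univ.erase i, ∏ j ∈ (univ.erase a).erase i, K (x a) (x j)) *
    (∏ a ∈ univ.erase i, W (x a)) ^ 2 with hrest
  have hrest_pos : 0 < rest := by
    refine mul_pos (prod_pos fun a _ => prod_pos fun j hj => hKpos a j ?_)
      (pow_pos (prod_pos fun a _ => hW0 _) 2)
    exact (ne_of_mem_erase (mem_of_mem_erase hj)).symm
  have hsplit (y : X) : Φ (Function.update x i y) =
      ((∏ j ∈ univ.erase i, K y (x j)) * W y) ^ 2 * rest := by
    have h1 : ∏ j ∈ univ.erase i,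
        K (Function.update x i y i) (Function.update x i y j) = ∏ j ∈ univ.erase i, K y (x j) := by
      refine prod_congr rfl fun j hj => ?_
      rw [Function.update_self, Function.update_of_ne (ne_of_mem_erase hj)]
    have h2 : ∏ a ∈ univ.erase i, ∏ j ∈ univ.erase a,
        K (Function.update x i y a) (Function.update x i y j) =
        (∏ a ∈ univ.erase i, K y (x a)) *
          ∏ a ∈ univ.erase i, ∏ j ∈ (univ.erase a).erase i, K (x a) (x j) := by
      rw [← prod_mul_distrib]
      refine prod_congr rfl fun a ha => ?_
      have hai := ne_of_mem_erase ha
      rw [← mul_prod_erase _ _ (mem_erase.2 ⟨hai.symm, mem_univ i⟩), Function.update_self,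
        Function.update_of_ne hai, hKsymm]
      congr 1
      refine prod_congr rfl fun j hj => ?_
      rw [Function.update_of_ne (ne_of_mem_erase hj)]
    have h3 : ∏ a ∈ univ.erase i, W (Function.update x i y a) = ∏ a ∈ univ.erase i, W (x a) := by
      refine prod_congr rfl fun j hj => ?_
      rw [Function.update_of_ne (ne_of_mem_erase hj)]
    simp only [hΦ]
    rw [← mul_prod_erase univ _ (mem_univ i), ← mul_prod_erase univ (fun a => W _) (mem_univ i),
      h1, h2, h3, Function.update_self, hrest]
    ring
  have hle : Φ (Function.update x i y) ≤ Φ (Function.update x i (x i)) := by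
    rw [Function.update_eq_self]
    exact hx (Set.mem_univ _)
  rw [hsplit, hsplit] at hle
  refine le_of_sq_le_sq (le_of_mul_le_mul_right hle hrest_pos) ?_
  exact mul_nonneg (prod_nonneg fun _ _ => hK0 _ _) (hW0 _).le

open Real Metric

lemma infinite_sphere_complex {R : ℝ} (hR : 0 < R) : (sphere (0 : ℂ) R).Infinite := by
  refine (isPreconnected_sphere (by simp) _ _).infinite_of_nontrivial
    ⟨R, by simp [abs_of_pos hR], -R, by simp [abs_of_pos hR], ?_⟩
  intro h
  have := congrArg Complex.re h
  simp at this
  linarith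

/-- Extremal nodes on a circle, with the extremality averaged over the circle. -/
lemma exists_nodes_circle {R : ℝ} (hR : 0 < R) (N : ℕ) {K : ℂ → ℂ → ℝ} {w : ℂ → ℝ} {κ : ℝ}
    (hK : ContinuousOn (fun p : ℂ × ℂ => K p.1 p.2) (sphere 0 R ×ˢ sphere 0 R))
    (hKsymm : ∀ a ∈ sphere (0 : ℂ) R, ∀ b ∈ sphere (0 : ℂ) R, K a b = K b a)
    (hK0 : ∀ a b, 0 ≤ K a b)
    (hKpos : ∀ a ∈ sphere (0 : ℂ) R, ∀ b ∈ sphere (0 : ℂ) R, a ≠ b → 0 < K a b)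
    (hKint : ∀ t ∈ sphere (0 : ℂ) R, CircleIntegrable (fun y => log (K y t)) 0 R)
    (hKavg : ∀ t ∈ sphere (0 : ℂ) R, κ ≤ circleAverage (fun y => log (K y t)) 0 R)
    (hw : ContinuousOn w (sphere 0 R)) (hw0 : ∀ z ∈ sphere (0 : ℂ) R, 0 < w z) (m : ℕ) :
    ∃ x : Fin N → ℂ, (∀ i, ‖x i‖ = R) ∧ (∀ i j, i ≠ j → 0 < K (x i) (x j)) ∧
      ∀ i, (N - 1) * κ - m * circleAverage (fun z => log (w z)) 0 R ≤
        ∑ j ∈ Finset.univ.erase i, log (K (x i) (x j)) - m * log (w (x i)) := by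
  have hcomp : CompactSpace (sphere (0 : ℂ) R) := isCompact_iff_compactSpace.1 (isCompact_sphere _ _)
  have hinf : Infinite (sphere (0 : ℂ) R) := (infinite_sphere_complex hR).to_subtype
  obtain ⟨x, hxpos, hx⟩ := exists_extremal_nodes (X := sphere (0 : ℂ) R) (N := N)
    (K := fun a b => K a b) (W := fun a => (w a ^ m)⁻¹)
    (hK.comp_continuous (by fun_prop : Continuous fun p : sphere (0 : ℂ) R × sphere (0 : ℂ) R =>
      ((p.1 : ℂ), (p.2 : ℂ))) fun p => ⟨p.1.2, p.2.2⟩)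
    (fun a b => hKsymm a a.2 b b.2) (fun a b => hK0 a b)
    ((hw.domRestrict.pow m).inv₀ fun a => (pow_pos (hw0 a a.2) m).ne')
    (fun a => inv_pos.2 (pow_pos (hw0 a a.2) m))
    -- A starting tuple of distinct points, so the maximum is positive and extremal points cannot
    -- annihilate the kernel.
    (fun i => Infinite.natEmbedding _ i)
    (fun i j hij => hKpos _ (Subtype.coe_prop _) _ (Subtype.coe_prop _) fun h => hij <|
      Fin.ext ((Infinite.natEmbedding _).injective (Subtype.ext h)))
  have habs : |R| = R := abs_of_pos hR
  refine ⟨fun i => x i, fun i => by simp, hxpos, fun i => ?_⟩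
  have hwint : CircleIntegrable (fun z => log (w z)) 0 R :=
    ContinuousOn.circleIntegrable hR.le (hw.log fun z hz => (hw0 z hz).ne')
  have hsumint : CircleIntegrable (fun y => ∑ j ∈ Finset.univ.erase i, log (K y (x j))) 0 R :=
    CircleIntegrable.fun_sum _ fun j _ => hKint _ (x j).2
  have hmint : CircleIntegrable (fun z => m * log (w z)) 0 R := hwint.const_smul (a := (m : ℝ))
  -- Average the extremality inequality over the competitor `y`. The nodes are left out because `K`
  -- may vanish on the diagonal.
  have h1 : circleAverage (fun y => ∑ j ∈ Finset.univ.erase i, log (K y (x j)) - m * log (w y)) 0 R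
      ≤ circleAverage (fun _ => ∑ j ∈ Finset.univ.erase i, log (K (x i) (x j)) -
        m * log (w (x i))) 0 R := by
    refine circleAverage_mono_of_countable hR.ne' (hsumint.sub hmint)
      (circleIntegrable_const _ _ _) (s := Set.range fun j => (x j : ℂ))
      (Set.countable_range _) fun y hy hys => ?_
    rw [habs] at hy
    have hKy (j) : 0 < K y (x j) := hKpos y hy _ (x j).2 fun h => hys ⟨j, h.symm⟩
    have hKx (j) (hj : j ∈ Finset.univ.erase i) : 0 < K (x i) (x j) :=
      hxpos i j (Finset.ne_of_mem_erase hj).symm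
    have hlog := log_le_log (mul_pos (Finset.prod_pos fun j _ => hKy j)
      (inv_pos.2 (pow_pos (hw0 y hy) m))) (hx i ⟨y, hy⟩)
    rwa [log_mul (Finset.prod_pos fun j _ => hKy j).ne' (inv_pos.2 (pow_pos (hw0 y hy) m)).ne',
      log_mul (Finset.prod_pos hKx).ne' (inv_pos.2 (pow_pos (hw0 _ (x i).2) m)).ne',
      log_prod fun j _ => (hKy j).ne', log_prod fun j hj => (hKx j hj).ne', log_inv, log_inv,
      log_pow, log_pow, ← sub_eq_add_neg, ← sub_eq_add_neg] at hlog
  rw [circleAverage_const, circleAverage_fun_sub hsumint hmint,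
    circleAverage_fun_sum fun j _ => hKint _ (x j).2] at h1
  have h2 : circleAverage (fun z => m * log (w z)) 0 R =
      m * circleAverage (fun z => log (w z)) 0 R := by
    simpa using circleAverage_fun_smul (a := (m : ℝ)) (f := fun z => log (w z)) (c := 0) (R := R)
  rw [h2] at h1
  refine le_trans (sub_le_sub_right ?_ _) h1
  have hcard : ((Finset.univ.erase i).card : ℝ) = N - 1 := by
    rw [Finset.card_erase_of_mem (Finset.mem_univ i), Finset.card_univ, Fintype.card_fin,
      Nat.cast_sub (by have := i.pos; omega), Nat.cast_one]
  rw [← hcard, ← nsmul_eq_mul]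
  exact Finset.card_nsmul_le_sum _ _ _ fun j _ => hKavg _ (x j).2

end Nodes

/-! ### The norm of a degeneration on circles -/

section NormOnCircles

open Real Metric

variable {k : ℕ} {ι κ : Fin k → Type}
variable [∀ j, Fintype (ι j)] [∀ j, DecidableEq (ι j)]
variable [∀ j, Fintype (κ j)]

lemma LaurentMap.continuousOn_eval {ι κ : Type} [Fintype ι] [DecidableEq ι] [Fintype κ]
    (A : LaurentMap κ ι) : ContinuousOn A.eval {0}ᶜ := by
  unfold LaurentMap.eval Finsupp.sum
  refine continuousOn_finsetSum _ fun m _ => ?_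
  exact ContinuousOn.fun_smul
    (fun z hz => (continuousAt_zpow₀ z m (Or.inl hz)).continuousWithinAt) continuousOn_const

/-- `∏ⱼ (‖Aⱼ(z)‖ + δ)`, a positive approximation of `‖A₁(z) ⊗ ⋯ ⊗ A_k(z)‖`. -/
def regNorm (A : ∀ j, LaurentMap (κ j) (ι j)) (δ : ℝ) (z : ℂ) : ℝ :=
  ∏ j, (‖(A j).eval z‖ + δ)

lemma normA_eq_regNorm_zero (A : ∀ j, LaurentMap (κ j) (ι j)) (z : ℂ) :
    normA A z = regNorm A 0 z := by
  simp [normA, regNorm, norm_tensorMatrix]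

lemma regNorm_pos (A : ∀ j, LaurentMap (κ j) (ι j)) {δ : ℝ} (hδ : 0 < δ) (z : ℂ) :
    0 < regNorm A δ z :=
  Finset.prod_pos fun _ _ => by positivity

lemma regNorm_mono (A : ∀ j, LaurentMap (κ j) (ι j)) {δ δ' : ℝ} (hδ : 0 ≤ δ) (h : δ ≤ δ')
    (z : ℂ) : regNorm A δ z ≤ regNorm A δ' z :=
  Finset.prod_le_prod (fun _ _ => by positivity) fun _ _ => by gcongr

lemma continuousOn_regNorm (A : ∀ j, LaurentMap (κ j) (ι j)) (δ : ℝ) :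
    ContinuousOn (regNorm A δ) {0}ᶜ :=
  continuousOn_finsetProd _ fun j _ => (A j).continuousOn_eval.norm.add continuousOn_const

lemma sphere_subset_compl_zero {R : ℝ} (hR : R ≠ 0) : sphere (0 : ℂ) |R| ⊆ {0}ᶜ := by
  rintro z hz rfl
  simp [eq_comm, hR] at hz

/-- The overlap of the target with the degenerating vector. -/
lemma IsDegeneration.exists_polynomial {A : ∀ j, LaurentMap (κ j) (ι j)} {ψ : State ι}
    {φ : State κ} {e : ℕ} (hA : IsDegeneration A ψ φ e) :
    ∃ p : Polynomial ℂ, p.eval 0 = 1 ∧ ∀ z ≠ 0, ‖p.eval z‖ ≤ normA A z := by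
  obtain ⟨Φ, hΦ0, hΦ⟩ := hA.expansion
  have hφ : ∑ x, ‖φ x‖ ^ 2 = 1 := hA.unit_target
  have hψ : ∑ x, ‖ψ x‖ ^ 2 = 1 := hA.unit_source
  -- This is `⟨φ, A(z) ψ⟩` for `z ≠ 0`; its constant term is `‖φ‖² = 1`, and Cauchy–Schwarz bounds
  -- it by `‖A(z)‖`.
  set p : Polynomial ℂ := ∑ h ∈ Finset.range (e + 1),
    Polynomial.C (star φ ⬝ᵥ Φ h) * Polynomial.X ^ h with hp
  have heval (z : ℂ) : p.eval z = ∑ h ∈ Finset.range (e + 1), (star φ ⬝ᵥ Φ h) * z ^ h := by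
    simp [hp, Polynomial.eval_finsetSum]
  refine ⟨p, ?_, fun z hz => ?_⟩
  · rw [heval, Finset.sum_range_succ']
    simp only [hΦ0, dotProduct, Pi.star_apply, RCLike.star_def, Complex.conj_mul']
    simp
    exact_mod_cast hφ
  · have h1 : p.eval z = star φ ⬝ᵥ (tensorMatrix (fun j => (A j).eval z) *ᵥ ψ) := by
      rw [hΦ z hz, heval, dotProduct_sum]
      exact Finset.sum_congr rfl fun h _ => by rw [dotProduct_smul, smul_eq_mul, mul_comm]
    set v := tensorMatrix (fun j => (A j).eval z) *ᵥ ψ with hv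
    refine le_of_sq_le_sq ?_ (norm_nonneg _)
    calc ‖p.eval z‖ ^ 2 ≤ (∑ x, ‖φ x‖ * ‖v x‖) ^ 2 := by
          rw [h1]
          gcongr
          refine (norm_sum_le _ _).trans_eq ?_
          simp
      _ ≤ (∑ x, ‖φ x‖ ^ 2) * ∑ x, ‖v x‖ ^ 2 := Finset.sum_mul_sq_le_sq_mul_sq _ _ _
      _ ≤ normA A z ^ 2 * ∑ x, ‖ψ x‖ ^ 2 := by
          rw [hφ, one_mul]
          exact sum_sq_mulVec_le _ _
      _ = normA A z ^ 2 := by rw [hψ, mul_one]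

lemma exists_le_of_continuousOn_sphere {f : ℂ → ℝ} {R : ℝ}
    (hf : ContinuousOn f (sphere 0 |R|)) : ∃ C, 1 ≤ C ∧ ∀ z ∈ sphere (0 : ℂ) |R|, f z ≤ C := by
  obtain ⟨C, hC⟩ := (isCompact_sphere (0 : ℂ) |R|).bddAbove_image hf
  exact ⟨max C 1, le_max_right _ _, fun z hz => (hC ⟨z, hz, rfl⟩).trans (le_max_left _ _)⟩

lemma circleIntegrable_log_norm_eval (p : Polynomial ℂ) (R : ℝ) :
    CircleIntegrable (fun z => log ‖p.eval z‖) 0 R :=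
  MeromorphicOn.circleIntegrable_log_norm fun z _ =>
    ((p.differentiable.analyticAt z).meromorphicAt)

variable {A : ∀ j, LaurentMap (κ j) (ι j)} {ψ : State ι} {φ : State κ} {e : ℕ}

lemma IsDegeneration.exists_countable (hA : IsDegeneration A ψ φ e) :
    ∃ s : Set ℂ, s.Countable ∧ ∀ z ≠ 0, z ∉ s → normA A z ≠ 0 := by
  obtain ⟨p, hp0, hp⟩ := hA.exists_polynomial
  have hpne : p ≠ 0 := by rintro rfl; simp at hp0
  refine ⟨p.rootSet ℂ, (p.rootSet_finite ℂ).countable, fun z hz hzs h0 => hzs ?_⟩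
  rw [Polynomial.mem_rootSet]
  exact ⟨hpne, by simpa using (hp z hz).trans_eq h0⟩

lemma continuousOn_normA (A : ∀ j, LaurentMap (κ j) (ι j)) : ContinuousOn (normA A) {0}ᶜ :=
  (continuousOn_regNorm A 0).congr fun z _ => normA_eq_regNorm_zero A z

/-- `log ‖A‖` is squeezed between `log |p|`, integrable for the overlap polynomial `p`, and a
constant. -/
lemma IsDegeneration.circleIntegrable_log_normA (hA : IsDegeneration A ψ φ e) {R : ℝ}
    (hR : R ≠ 0) : CircleIntegrable (fun z => log (normA A z)) 0 R := by
  obtain ⟨p, hp0, hp⟩ := hA.exists_polynomial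
  have hpne : p ≠ 0 := by rintro rfl; simp at hp0
  have hcont := (continuousOn_normA A).mono (sphere_subset_compl_zero hR)
  obtain ⟨C, hC1, hC⟩ := exists_le_of_continuousOn_sphere hcont
  have hmem := circleMap_mem_sphere' (0 : ℂ) R
  refine IntervalIntegrable.mono_fun' (g := fun θ => |log ‖p.eval (circleMap 0 R θ)‖| + log C)
    (IntervalIntegrable.add (circleIntegrable_log_norm_eval p R).abs intervalIntegrable_const) ?_ ?_
  · have : Continuous fun θ => normA A (circleMap 0 R θ) :=
      hcont.comp_continuous (continuous_circleMap 0 R) hmem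
    exact (measurable_log.comp this.measurable).aestronglyMeasurable
  · refine ae_restrict_of_ae ?_
    filter_upwards [ae_circleMap_notMem_of_countable (p.rootSet_finite ℂ).countable 0 hR] with θ hθ
    have hz := sphere_subset_compl_zero hR (hmem θ)
    have hpos : 0 < ‖p.eval (circleMap 0 R θ)‖ := by
      rw [norm_pos_iff]
      intro h0
      exact hθ (Polynomial.mem_rootSet.2 ⟨hpne, by simpa using h0⟩)
    have h1 := log_le_log hpos (hp _ hz)
    have h2 := log_le_log (hpos.trans_le (hp _ hz)) (hC _ (hmem θ))
    have h3 := log_nonneg hC1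
    rw [norm_eq_abs, abs_le]
    constructor
    · linarith [neg_abs_le (log ‖p.eval (circleMap 0 R θ)‖)]
    · linarith [abs_nonneg (log ‖p.eval (circleMap 0 R θ)‖)]

/-- Jensen's formula: the difference is a sum of `log (R / |u|) ≥ 0` over the zeros `u` in the disc,
with multiplicity. -/
lemma log_norm_eval_zero_le_circleAverage (p : Polynomial ℂ) (hp : p.eval 0 ≠ 0) {R : ℝ}
    (hR : 0 < R) : log ‖p.eval 0‖ ≤ circleAverage (fun z => log ‖p.eval z‖) 0 R := by
  have han : AnalyticOnNhd ℂ (fun z => p.eval z) (closedBall 0 |R|) :=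
    fun z _ => p.differentiable.analyticAt z
  have h := han.circleAverage_log_norm hR.ne' hp
  rw [h]
  refine le_add_of_nonneg_left (finsum_nonneg fun u => ?_)
  by_cases hu : u ∈ closedBall (0 : ℂ) |R|
  · refine mul_nonneg (by exact_mod_cast MeromorphicOn.AnalyticOnNhd.divisor_nonneg han u) ?_
    by_cases hu0 : u = 0
    · simp [hu0]
    refine log_nonneg ?_
    have hun : 0 < ‖u‖ := norm_pos_iff.2 hu0
    have : ‖u‖ ≤ R := by simpa [abs_of_pos hR] using hu
    rw [zero_sub, norm_neg, ← div_eq_mul_inv, one_le_div hun]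
    exact this
  · rw [Function.locallyFinsuppWithin.apply_eq_zero_of_notMem _ hu]
    simp

lemma IsDegeneration.circleAverage_log_normA_nonneg (hA : IsDegeneration A ψ φ e) {R : ℝ}
    (hR : 0 < R) : 0 ≤ circleAverage (fun z => log (normA A z)) 0 R := by
  obtain ⟨p, hp0, hp⟩ := hA.exists_polynomial
  have hpne : p ≠ 0 := by rintro rfl; simp at hp0
  have h := log_norm_eval_zero_le_circleAverage p (by simp [hp0]) hR
  rw [hp0, norm_one, log_one] at h
  refine h.trans (circleAverage_mono_of_countable hR.ne' (circleIntegrable_log_norm_eval p R)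
    (hA.circleIntegrable_log_normA hR.ne') (p.rootSet_finite ℂ).countable fun z hz hzs => ?_)
  refine log_le_log (norm_pos_iff.2 fun h0 => hzs ?_) (hp z (sphere_subset_compl_zero hR.ne' hz))
  exact Polynomial.mem_rootSet.2 ⟨hpne, by simpa using h0⟩

/-- The average of `log ∏ⱼ (‖Aⱼ‖ + δ)` is close to that of `log ‖A₁ ⊗ ⋯ ⊗ A_k‖`. -/
lemma IsDegeneration.exists_circleAverage_log_regNorm_lt (hA : IsDegeneration A ψ φ e) {R : ℝ}
    (hR : 0 < R) {ε : ℝ} (hε : 0 < ε) : ∃ δ, 0 < δ ∧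
      circleAverage (fun z => log (regNorm A δ z)) 0 R <
        circleAverage (fun z => log (normA A z)) 0 R + ε := by
  obtain ⟨s, hs, hsn⟩ := hA.exists_countable
  have hsub := sphere_subset_compl_zero hR.ne'
  have hcont (δ : ℝ) := (continuousOn_regNorm A δ).mono hsub
  obtain ⟨C, -, hC⟩ := exists_le_of_continuousOn_sphere (hcont 1)
  have hδ (m : ℕ) : 0 < 1 / ((m : ℝ) + 1) := by positivity
  have hlim := tendsto_circleAverage_log (w := fun m => regNorm A (1 / ((m : ℝ) + 1))) (C := C)
    hR.ne' one_pos (hA.circleIntegrable_log_normA hR.ne') (fun z _ => norm_nonneg _) hs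
    (fun z hz => hsn z (hsub hz)) (fun m => hcont _)
    (fun m z _ => by
      rw [one_mul, normA_eq_regNorm_zero]
      exact regNorm_mono A le_rfl (hδ m).le z)
    (fun m z hz => (regNorm_mono A (hδ m).le
      (by rw [div_le_one (by positivity)]; linarith [m.cast_nonneg (α := ℝ)]) z).trans (hC z hz))
    (fun z _ => by
      rw [normA_eq_regNorm_zero]
      exact tendsto_finsetProd _ fun j _ =>
        tendsto_const_nhds.add tendsto_one_div_add_atTop_nhds_zero_nat)
  obtain ⟨m, hm⟩ := (hlim.eventually (gt_mem_nhds (lt_add_of_pos_right _ hε))).exists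
  exact ⟨_, hδ m, hm⟩

end NormOnCircles

/-! ### Interpolation protocols with nodes on a circle -/

section Protocols

open Real Metric

variable {k : ℕ} {ι κ : Fin k → Type}
variable [∀ j, Fintype (ι j)] [∀ j, Fintype (κ j)]

/-- `X ^ h` has degree below `N`, so it equals its own interpolant; evaluate at `0`. -/
lemma sum_pow_mul_lagrange_basis {N : ℕ} {z : Fin N → ℂ} (hz : Function.Injective z) {h : ℕ}
    (hh : h < N) : ∑ i, z i ^ h * (Lagrange.basis Finset.univ z i).eval 0 =
      if h = 0 then 1 else 0 := by
  have key := Lagrange.eq_interpolate (s := Finset.univ) (v := z) (f := Polynomial.X ^ h)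
    (hz.injOn) (by simpa using hh)
  have h0 := congrArg (Polynomial.eval 0) key
  rw [Lagrange.interpolate_apply, Polynomial.eval_finsetSum] at h0
  simp only [Polynomial.eval_mul, Polynomial.eval_C, Polynomial.eval_pow, Polynomial.eval_X] at h0
  rw [← h0, zero_pow_eq]

lemma norm_eval_lagrange_basis {N : ℕ} {z : Fin N → ℂ} {R : ℝ} (hz : ∀ i, ‖z i‖ = R) (i : Fin N) :
    ‖(Lagrange.basis Finset.univ z i).eval 0‖ = ∏ j ∈ Finset.univ.erase i, (R / ‖z i - z j‖) := by
  rw [Lagrange.basis, Polynomial.eval_prod, norm_prod]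
  refine Finset.prod_congr rfl fun j _ => ?_
  simp [Lagrange.basisDivisor, hz, div_eq_inv_mul]

/-- With kernel `|a - b|` the average is exactly `κ = log R`, and the `N - 1 = n * e` copies of it
cancel the powers of `R` in the Lagrange coefficients. Hence no error term appears. -/
lemma exists_nodes_protocol [∀ j, DecidableEq (ι j)]
    (A : ∀ j, LaurentMap (κ j) (ι j)) (e n : ℕ) {R : ℝ} (hR : 0 < R) {δ : ℝ} (hδ : 0 < δ) :
    ∃ z : Fin (n * e + 1) → ℂ, (∀ i, ‖z i‖ = R) ∧ Function.Injective z ∧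
      ∀ i, ‖(Lagrange.basis Finset.univ z i).eval 0‖ * regNorm A δ (z i) ^ n ≤
        exp (n * circleAverage (fun z => log (regNorm A δ z)) 0 R) := by
  have hsub : sphere (0 : ℂ) R ⊆ {0}ᶜ := by
    simpa [abs_of_pos hR] using sphere_subset_compl_zero hR.ne'
  obtain ⟨z, hz, hzpos, hzi⟩ := exists_nodes_circle hR (n * e + 1) (K := fun a b => ‖a - b‖)
    (w := regNorm A δ) (κ := log R) (by fun_prop) (fun a _ b _ => norm_sub_rev a b)
    (fun a b => norm_nonneg _) (fun a _ b _ hab => norm_pos_iff.2 (sub_ne_zero.2 hab))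
    (fun t _ => circleIntegrable_log_norm_sub_const _)
    (fun t ht => (circleAverage_log_norm_sub_const_of_mem_closedBall (by
      rw [abs_of_pos hR]; exact sphere_subset_closedBall ht)).ge)
    ((continuousOn_regNorm A δ).mono hsub) (fun z _ => regNorm_pos A hδ z) n
  have hinj : Function.Injective z := by
    intro i j hij
    by_contra hne
    simpa [hij] using hzpos i j hne
  refine ⟨z, hz, hinj, fun i => ?_⟩
  have hd (j) (hj : j ∈ Finset.univ.erase i) : 0 < ‖z i - z j‖ :=
    hzpos i j (Finset.ne_of_mem_erase hj).symm
  have hprod : 0 < ∏ j ∈ Finset.univ.erase i, (R / ‖z i - z j‖) :=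
    Finset.prod_pos fun j hj => div_pos hR (hd j hj)
  have hw := pow_pos (regNorm_pos A hδ (z i)) n
  rw [norm_eval_lagrange_basis hz, ← log_le_iff_le_exp (mul_pos hprod hw),
    log_mul hprod.ne' hw.ne', log_prod fun j hj => (div_pos hR (hd j hj)).ne', log_pow]
  have hsum : ∑ j ∈ Finset.univ.erase i, log (R / ‖z i - z j‖) =
      (n * e : ℕ) * log R - ∑ j ∈ Finset.univ.erase i, log ‖z i - z j‖ := by
    rw [Finset.sum_congr rfl fun j hj => log_div hR.ne' (hd j hj).ne', Finset.sum_sub_distrib]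
    simp
  have := hzi i
  rw [hsum]
  push_cast at this ⊢
  linarith

variable [∀ j, DecidableEq (κ j)] {A : ∀ j, LaurentMap (κ j) (ι j)} {e n t : ℕ}

lemma Protocol.sum_pos (P : Protocol A e n t) :
    0 < ∑ i, ‖P.c i‖ ^ 2 / ‖∏ j, P.γ j i‖ ^ 2 := by
  have hex : ∃ i, P.c i ≠ 0 := by
    by_contra! h
    simpa [h] using P.interpolation 0 (Nat.zero_le _)
  obtain ⟨i, hi⟩ := hex
  have hγ : ∏ j, P.γ j i ≠ 0 := Finset.prod_ne_zero_iff.2 fun j _ => P.γ_ne_zero j i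
  exact Finset.sum_pos' (fun _ _ => by positivity) ⟨i, Finset.mem_univ i, by positivity⟩

lemma Protocol.successProb_pos (P : Protocol A e n t) : 0 < P.successProb :=
  inv_pos.2 P.sum_pos

/-- Shrinking the operators of one party lowers the success probability at will. -/
lemma Protocol.exists_successProb_eq (P : Protocol A e n t) (j₀ : Fin k) {q : ℝ} (hq : 0 < q)
    (hqP : q ≤ P.successProb) : ∃ Q : Protocol A e n t, Q.successProb = q := by
  set s : ℝ := √(q / P.successProb) with hs
  have hs2 : s ^ 2 = q / P.successProb := sq_sqrt (div_pos hq P.successProb_pos).le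
  have hs0 : 0 < s := sqrt_pos.2 (div_pos hq P.successProb_pos)
  have hs1 : s ^ 2 ≤ 1 := hs2.trans_le ((div_le_one P.successProb_pos).2 hqP)
  set a : Fin k → ℝ := Function.update (fun _ => 1) j₀ s with ha
  have ha0 (j) : 0 < a j := by
    by_cases h : j = j₀
    · subst h; simpa [ha] using hs0
    · simp [ha, h]
  have ha1 (j) : a j ^ 2 ≤ 1 := by
    by_cases h : j = j₀
    · subst h; simpa [ha] using hs1
    · simp [ha, h]
  have hprod : ∏ j, a j = s := by
    rw [← Finset.mul_prod_erase _ _ (Finset.mem_univ j₀), Finset.prod_eq_one]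
    · simp [ha]
    · intro j hj
      simp [ha, Finset.ne_of_mem_erase hj]
  refine ⟨⟨P.z, P.c, fun j i => (a j : ℂ) * P.γ j i, P.z_ne_zero, fun j i =>
    mul_ne_zero (by exact_mod_cast (ha0 j).ne') (P.γ_ne_zero j i), P.interpolation, fun j => ?_⟩, ?_⟩
  · have h (i) : ((‖(a j : ℂ) * P.γ j i‖ ^ 2 : ℝ) : ℂ) =
        ((a j ^ 2 : ℝ) : ℂ) * ((‖P.γ j i‖ ^ 2 : ℝ) : ℂ) := by
      rw [norm_mul, mul_pow, Complex.norm_real, norm_eq_abs, sq_abs, Complex.ofReal_mul]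
    simp only [h, mul_smul, ← Finset.smul_sum]
    rw [norm_smul, Complex.norm_real, norm_eq_abs, abs_of_nonneg (sq_nonneg _)]
    exact mul_le_one₀ (ha1 j) (norm_nonneg _) (P.contraction j)
  · have h (i) : ‖∏ j, (a j : ℂ) * P.γ j i‖ ^ 2 = s ^ 2 * ‖∏ j, P.γ j i‖ ^ 2 := by
      rw [Finset.prod_mul_distrib, ← Complex.ofReal_prod, hprod, norm_mul, mul_pow,
        Complex.norm_real, norm_eq_abs, sq_abs]
    simp only [Protocol.successProb, h]
    simp only [mul_comm (s ^ 2), ← div_div, ← Finset.sum_div]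
    rw [inv_div, hs2, Protocol.successProb]
    have := P.sum_pos
    field_simp

/-- The factor `N ^ (-1/2)` in each `γ j i` makes every summand of the contraction condition at most
`1 / N`. The price is `N ^ k` over the `k` parties and one more `N` from summing over the nodes. -/
lemma exists_protocol [∀ j, DecidableEq (ι j)] (A : ∀ j, LaurentMap (κ j) (ι j)) (e n : ℕ)
    {R : ℝ} (hR : 0 < R) {δ : ℝ} (hδ : 0 < δ) : ∃ P : Protocol A e n (n * e + 1),
      (((n * e + 1 : ℕ) : ℝ) ^ (k + 1))⁻¹ *
        exp (-(n * (2 * circleAverage (fun z => log (regNorm A δ z)) 0 R))) ≤ P.successProb := by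
  have hnodes := exists_nodes_protocol A e n hR hδ
  set L := circleAverage (fun z => log (regNorm A δ z)) 0 R with hL
  generalize hN : n * e + 1 = N at hnodes ⊢
  obtain ⟨z, hz, hinj, hzc⟩ := hnodes
  have hNpos : (0 : ℝ) < N := by rw [← hN]; positivity
  set b : Fin k → Fin N → ℝ := fun j i => ‖(A j).eval (z i)‖ + δ with hb
  have hbpos (j i) : 0 < b j i := by positivity
  set g : Fin k → Fin N → ℝ := fun j i => (√N)⁻¹ * (b j i ^ n)⁻¹ with hg
  have hgpos (j i) : 0 < g j i :=
    mul_pos (inv_pos.2 (sqrt_pos.2 hNpos)) (inv_pos.2 (pow_pos (hbpos j i) n))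
  have hgnorm (j i) : ‖(g j i : ℂ)‖ ^ 2 = (N : ℝ)⁻¹ * ((b j i ^ n) ^ 2)⁻¹ := by
    rw [Complex.norm_real, norm_eq_abs, sq_abs, mul_pow, inv_pow, inv_pow, sq_sqrt hNpos.le]
  set P : Protocol A e n N :=
    { z := z
      c := fun i => (Lagrange.basis Finset.univ z i).eval 0
      γ := fun j i => (g j i : ℂ)
      z_ne_zero := fun i => norm_pos_iff.1 (by rw [hz]; exact hR)
      γ_ne_zero := fun j i => by exact_mod_cast (hgpos j i).ne'
      interpolation := fun h hh => sum_pow_mul_lagrange_basis hinj (by omega)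
      contraction := fun j => by
        refine (norm_sum_le _ _).trans ?_
        have hterm (i : Fin N) : ‖((‖(g j i : ℂ)‖ ^ 2 : ℝ) : ℂ) • (powMatrix n ((A j).eval (z i)) *
            (powMatrix n ((A j).eval (z i)))ᴴ)‖ ≤ (N : ℝ)⁻¹ := by
          rw [norm_smul, Complex.norm_real, norm_eq_abs, abs_of_nonneg (sq_nonneg _), hgnorm,
            mul_assoc]
          refine mul_le_of_le_one_right (by positivity) ?_
          rw [inv_mul_le_one₀ (by have := hbpos j i; positivity)]
          refine (Matrix.l2_opNorm_mul _ _).trans ?_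
          rw [Matrix.l2_opNorm_conjTranspose, ← sq]
          gcongr
          refine (norm_powMatrix_le _ _).trans ?_
          gcongr
          simp [hb, hδ.le]
        refine (Finset.sum_le_sum fun i _ => hterm i).trans_eq ?_
        simp [hNpos.ne'] } with hP
  refine ⟨P, ?_⟩
  have hγ (i : Fin N) : ‖∏ j, P.γ j i‖ ^ 2 = ((N : ℝ) ^ k)⁻¹ * ((regNorm A δ (z i) ^ n) ^ 2)⁻¹ := by
    rw [norm_prod, ← Finset.prod_pow]
    simp only [hP, hgnorm, Finset.prod_mul_distrib, Finset.prod_inv_distrib, Finset.prod_pow,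
      Finset.prod_const, Finset.card_univ, Fintype.card_fin, regNorm, hb]
  have hterm (i : Fin N) : ‖P.c i‖ ^ 2 / ‖∏ j, P.γ j i‖ ^ 2 ≤ (N : ℝ) ^ k * exp (n * L) ^ 2 := by
    rw [hγ, div_eq_mul_inv, mul_inv, inv_inv, inv_inv, mul_left_comm, ← mul_pow]
    have := (regNorm_pos A hδ (z i)).le
    gcongr
    exact hzc i
  rw [Protocol.successProb, exp_neg, ← mul_inv]
  refine inv_anti₀ P.sum_pos ((Finset.sum_le_sum fun i _ => hterm i).trans_eq ?_)
  have hexp : exp (n * L) ^ 2 = exp (n * (2 * L)) := by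
    rw [← exp_nat_mul]
    congr 1
    push_cast
    ring
  rw [Finset.sum_const, Finset.card_univ, Fintype.card_fin, nsmul_eq_mul, hexp]
  ring

end Protocols

/-! ### Exponents -/

section Exponents

open Real

/-- The crude bound `log x = 2 log √x ≤ 2 √x` suffices. -/
lemma subexponential_mul_add_one (e : ℕ) : Subexponential fun n => n * e + 1 := by
  unfold Subexponential
  have hlim : Tendsto (fun n : ℕ => 2 * √(e + 1) / log 2 / √n) atTop (𝓝 0) :=
    tendsto_const_nhds.div_atTop (tendsto_sqrt_atTop.comp tendsto_natCast_atTop_atTop)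
  refine squeeze_zero' (Eventually.of_forall fun n => ?_) ?_ hlim
  · exact div_nonneg (logb_nonneg one_lt_two (by simp; positivity)) n.cast_nonneg
  · filter_upwards [eventually_ge_atTop 1] with n hn
    have hn' : (1 : ℝ) ≤ n := by exact_mod_cast hn
    have hn0 : (0 : ℝ) < n := by linarith
    have hlog2 := log_pos one_lt_two
    have h1 : log ((n * e + 1 : ℕ) : ℝ) ≤ 2 * (√(e + 1) * √n) := by
      rw [← sqrt_mul (by positivity)]
      calc log ((n * e + 1 : ℕ) : ℝ) ≤ log ((e + 1) * n) := by
            push_cast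
            exact log_le_log (by positivity) (by nlinarith)
        _ = 2 * log (√((e + 1) * n)) := by rw [log_sqrt (by positivity)]; ring
        _ ≤ 2 * √((e + 1) * n) := by
            gcongr
            exact log_le_self (sqrt_nonneg _)
    have hsq : √(n : ℝ) ^ 2 = n := sq_sqrt hn0.le
    have hs0 : 0 < √(n : ℝ) := sqrt_pos.2 hn0
    rw [logb, div_div, div_div, div_le_div_iff₀ (by positivity) (by positivity)]
    calc log ((n * e + 1 : ℕ) : ℝ) * (log 2 * √n) ≤ 2 * (√(e + 1) * √n) * (log 2 * √n) := by
          gcongr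
      _ = 2 * √(e + 1) * (log 2 * √n ^ 2) := by ring
      _ = _ := by rw [hsq]

lemma hasExponent_of_tendsto {p : ℕ → ℝ} {r : ℝ}
    (h : Tendsto (fun n : ℕ => logb 2 (p n) / n) atTop (𝓝 (-r))) : HasExponent p r := by
  unfold HasExponent
  have h' := (continuous_coe_real_ereal.tendsto (-r)).comp h
  rw [show (fun n : ℕ => ((logb 2 (p n) / n : ℝ) : EReal)) =
    Real.toEReal ∘ fun n : ℕ => logb 2 (p n) / n from rfl, h'.liminf_eq]
  simp

variable {k : ℕ} {ι κ : Fin k → Type}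
variable [∀ j, Fintype (ι j)] [∀ j, Fintype (κ j)] [∀ j, DecidableEq (κ j)]
variable {A : ∀ j, LaurentMap (κ j) (ι j)} {e : ℕ}

/-- `HasExponent` demands equality, so each protocol is weakened until its probability equals the
guaranteed lower bound with `ε = 1 / (n + 1)`; then the exponent is a genuine limit. -/
lemma exists_protocols_hasExponent (hk : 0 < k) {r : ℝ}
    (h : ∀ ε : ℝ, 0 < ε → ∀ n : ℕ, ∃ P : Protocol A e n (n * e + 1),
      (((n * e + 1 : ℕ) : ℝ) ^ (k + 1))⁻¹ * (2 : ℝ) ^ (-(n * (r + ε))) ≤ P.successProb) :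
    ∃ P : ∀ n, Protocol A e n (n * e + 1), HasExponent (fun n => (P n).successProb) r := by
  have hε (n : ℕ) : 0 < 1 / ((n : ℝ) + 1) := by positivity
  choose P hP using fun n => h _ (hε n) n
  choose Q hQ using fun n => (P n).exists_successProb_eq ⟨0, hk⟩ (by positivity) (hP n)
  refine ⟨Q, hasExponent_of_tendsto ?_⟩
  have hlim : Tendsto (fun n : ℕ => -((k + 1 : ℕ) * (logb 2 ((n * e + 1 : ℕ) : ℝ) / n)) -
      (r + 1 / ((n : ℝ) + 1))) atTop (𝓝 (-r)) := by
    have h1 := (subexponential_mul_add_one e).const_mul ((k + 1 : ℕ) : ℝ)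
    have h2 := (tendsto_one_div_add_atTop_nhds_zero_nat (𝕜 := ℝ)).const_add r
    simpa using h1.neg.sub h2
  refine hlim.congr' ?_
  filter_upwards [eventually_ge_atTop 1] with n hn
  have hn' : (n : ℝ) ≠ 0 := by positivity
  rw [hQ, logb_mul (by positivity) (by positivity), logb_inv, logb_pow,
    logb_rpow two_pos (by norm_num)]
  field_simp
  ring

end Exponents

/-! ### The protocols as LOCC transformations -/

section LOCC

variable {k : ℕ}

lemma sum_ghz_mul (hk : 0 < k) {t : ℕ} (F : (Fin k → Fin t) → ℂ) :
    ∑ u, ghz k t u * F u = (((Real.sqrt t)⁻¹ : ℝ) : ℂ) * ∑ i, F fun _ => i := by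
  rw [Finset.mul_sum]
  symm
  refine Fintype.sum_of_injective (fun i _ => i) (fun a b h => congrFun h ⟨0, hk⟩) _ _ ?_ ?_
  · intro u hu
    have : ¬ ∃ i, ∀ j, u j = i := fun ⟨i, hi⟩ => hu ⟨i, funext fun j => (hi j).symm⟩
    simp [ghz, this]
  · intro i
    rw [ghz, if_pos ⟨i, fun _ => rfl⟩]

variable {ι κ : Fin k → Type} [∀ j, Fintype (ι j)]

/-- Applying `∑ᵢ bⱼᵢ ⟨i| ⊗ Cⱼᵢ` at every party to `GHZ ⊗ χ`. -/
lemma tensorMatrix_mulVec_stateProd_ghz (hk : 0 < k) {t : ℕ} (b : Fin k → Fin t → ℂ)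
    (C : ∀ j, Fin t → Matrix (κ j) (ι j) ℂ) (χ : State ι) :
    (tensorMatrix fun j => Matrix.of fun (x : κ j) (p : Fin t × ι j) => b j p.1 * C j p.1 x p.2) *ᵥ
        stateProd (ghz k t) χ =
      (((Real.sqrt t)⁻¹ : ℝ) : ℂ) • ∑ i, (∏ j, b j i) • (tensorMatrix (fun j => C j i) *ᵥ χ) := by
  ext x
  let E : (∀ j, Fin t × ι j) ≃ (Fin k → Fin t) × ∀ j, ι j :=
    { toFun := fun y => (fun j => (y j).1, fun j => (y j).2)
      invFun := fun p j => (p.1 j, p.2 j)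
      left_inv := fun _ => rfl
      right_inv := fun _ => rfl }
  have h1 : ((tensorMatrix fun j => Matrix.of fun (x : κ j) (p : Fin t × ι j) =>
      b j p.1 * C j p.1 x p.2) *ᵥ stateProd (ghz k t) χ) x =
      ∑ u : Fin k → Fin t, ghz k t u *
        ∑ v : ∀ j, ι j, (∏ j, b j (u j)) * ((∏ j, C j (u j) (x j) (v j)) * χ v) := by
    simp only [Matrix.mulVec, dotProduct, Finset.mul_sum]
    rw [← Fintype.sum_prod_type', ← E.sum_comp]
    refine Finset.sum_congr rfl fun y _ => ?_
    simp only [tensorMatrix, Matrix.of_apply, stateProd, Finset.prod_mul_distrib, E,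
      Equiv.coe_fn_mk]
    ring
  rw [h1, sum_ghz_mul hk]
  simp [tensorMatrix, Matrix.mulVec, dotProduct, Finset.mul_sum]

lemma tensorMatrix_powMatrix_mulVec_statePow (n : ℕ) (M : ∀ j, Matrix (κ j) (ι j) ℂ)
    (ψ : State ι) : (tensorMatrix fun j => powMatrix n (M j)) *ᵥ statePow n ψ =
      statePow n (tensorMatrix M *ᵥ ψ) := by
  ext x
  simp only [statePow, Matrix.mulVec, dotProduct, tensorMatrix, powMatrix, Matrix.of_apply]
  rw [Finset.prod_univ_sum, Fintype.piFinset_univ,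
    ← (Equiv.piComm fun (_ : Fin n) (j : Fin k) => ι j).sum_comp]
  refine Finset.sum_congr rfl fun y _ => ?_
  rw [Finset.prod_comm, ← Finset.prod_mul_distrib]
  rfl

variable [∀ j, Fintype (κ j)] [∀ j, DecidableEq (κ j)]
variable {A : ∀ j, LaurentMap (κ j) (ι j)} {ψ : State ι} {φ : State κ} {e n t : ℕ}

lemma Protocol.sum_eval (P : Protocol A e n t) (q : Polynomial ℂ) (hq : q.natDegree ≤ n * e) :
    ∑ i, P.c i * q.eval (P.z i) = q.eval 0 := by
  simp only [Polynomial.eval_eq_sum_range' (Nat.lt_succ_of_le hq), Finset.mul_sum]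
  rw [Finset.sum_comm]
  refine Finset.sum_congr rfl fun h hh => ?_
  have := P.interpolation h (Nat.lt_succ_iff.1 (Finset.mem_range.1 hh))
  rw [zero_pow_eq, ← this, Finset.mul_sum]
  exact Finset.sum_congr rfl fun i _ => by ring

/-- Each coordinate of `(A(z) ψ)^{⊗ n}` is a polynomial in `z` of degree at most `n * e`, and the
weights `c` evaluate such polynomials at `0`. -/
lemma Protocol.sum_statePow (P : Protocol A e n t) (hA : IsDegeneration A ψ φ e) :
    ∑ i, P.c i • statePow n (tensorMatrix (fun j => (A j).eval (P.z i)) *ᵥ ψ) = statePow n φ := by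
  obtain ⟨Φ, hΦ0, hΦ⟩ := hA.expansion
  ext x
  set q : Polynomial ℂ := ∏ m : Fin n, ∑ h ∈ Finset.range (e + 1),
    Polynomial.C (Φ h fun j => x j m) * Polynomial.X ^ h with hq
  have hdeg : q.natDegree ≤ n * e := by
    refine (Polynomial.natDegree_prod_le _ _).trans ?_
    refine (Finset.sum_le_card_nsmul _ _ e fun m _ => ?_).trans (by simp)
    refine Polynomial.natDegree_sum_le_of_forall_le _ _ fun h hh => ?_
    exact (Polynomial.natDegree_C_mul_X_pow_le _ _).trans
      (Nat.lt_succ_iff.1 (Finset.mem_range.1 hh))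
  have heval (z : ℂ) : q.eval z = ∏ m : Fin n, ∑ h ∈ Finset.range (e + 1),
      Φ h (fun j => x j m) * z ^ h := by
    simp [hq, Polynomial.eval_prod, Polynomial.eval_finsetSum]
  have h0 : q.eval 0 = statePow n φ x := by
    rw [heval, statePow]
    refine Finset.prod_congr rfl fun m _ => ?_
    rw [Finset.sum_range_succ']
    simp [hΦ0]
  rw [← h0, ← P.sum_eval q hdeg, Finset.sum_apply]
  refine Finset.sum_congr rfl fun i _ => ?_
  rw [hΦ _ (P.z_ne_zero i), Pi.smul_apply, smul_eq_mul, heval]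
  simp [statePow, mul_comm]

/-- The operator that party `j` applies in the protocol. -/
def Protocol.localMap (P : Protocol A e n t) (σ : Equiv.Perm (Fin t)) (j : Fin k) :
    Matrix (Fin n → κ j) (Fin t × (Fin n → ι j)) ℂ :=
  Matrix.of fun x p => P.γ j (σ p.1) * powMatrix n ((A j).eval (P.z (σ p.1))) x p.2

lemma Protocol.localMap_mul_conjTranspose (P : Protocol A e n t) (σ : Equiv.Perm (Fin t))
    (j : Fin k) : P.localMap σ j * (P.localMap σ j)ᴴ = ∑ i, ((‖P.γ j i‖ ^ 2 : ℝ) : ℂ) •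
      (powMatrix n ((A j).eval (P.z i)) * (powMatrix n ((A j).eval (P.z i)))ᴴ) := by
  ext x y
  rw [← Equiv.sum_comp σ]
  simp only [localMap, Matrix.mul_apply, Matrix.conjTranspose_apply, Matrix.of_apply,
    Fintype.sum_prod_type, Matrix.sum_apply, Matrix.smul_apply, Finset.mul_sum, smul_eq_mul,
    star_mul']
  refine Finset.sum_congr rfl fun i _ => Finset.sum_congr rfl fun v _ => ?_
  rw [Complex.ofReal_pow, ← Complex.mul_conj']
  simp only [RCLike.star_def]
  ring

/-- The amplitudes `cᵢ / gᵢ` of the weighted GHZ state that the protocol starts from. -/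
def Protocol.amplitude (P : Protocol A e n t) (i : Fin t) : ℂ :=
  (Real.sqrt P.successProb : ℂ) * (P.c i / ∏ j, P.γ j i)

lemma Protocol.sum_norm_sq_amplitude (P : Protocol A e n t) : ∑ i, ‖P.amplitude i‖ ^ 2 = 1 := by
  have h (i) : ‖P.amplitude i‖ ^ 2 = P.successProb * (‖P.c i‖ ^ 2 / ‖∏ j, P.γ j i‖ ^ 2) := by
    rw [amplitude, norm_mul, norm_div, mul_pow, div_pow, Complex.norm_real, Real.norm_eq_abs,
      sq_abs, Real.sq_sqrt P.successProb_pos.le]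
  simp only [h, ← Finset.mul_sum]
  exact inv_mul_cancel₀ P.sum_pos.ne'

lemma Protocol.prod_mul_amplitude (P : Protocol A e n t) (i : Fin t) :
    (∏ j, P.γ j i) * P.amplitude i = Real.sqrt P.successProb * P.c i := by
  have hγ : ∏ j, P.γ j i ≠ 0 := Finset.prod_ne_zero_iff.2 fun j _ => P.γ_ne_zero j i
  rw [amplitude]
  field_simp

variable [∀ j, DecidableEq (ι j)]

/-- The C*-identity turns the contraction condition into a norm bound. -/
lemma Protocol.norm_localMap_le (P : Protocol A e n t) (σ : Equiv.Perm (Fin t)) (j : Fin k) :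
    ‖P.localMap σ j‖ ≤ 1 := by
  have h := P.contraction j
  rw [← P.localMap_mul_conjTranspose σ j] at h
  have h2 := Matrix.l2_opNorm_conjTranspose_mul_self (P.localMap σ j)ᴴ
  rw [Matrix.conjTranspose_conjTranspose, Matrix.l2_opNorm_conjTranspose] at h2
  rw [h2] at h
  nlinarith [norm_nonneg (P.localMap σ j)]

/-- Two rounds: a measurement reweights the GHZ state to the amplitudes of `P`, up to a cyclic shift
announced by the party `j₀`; then all parties apply their correspondingly shifted `localMap`. -/
theorem Protocol.loccReaches (hk : 0 < k) (P : Protocol A e n t) (hA : IsDegeneration A ψ φ e) :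
    LOCCReaches (statePow n φ) (stateProd (ghz k t) (statePow n ψ)) P.successProb := by
  have ht : NeZero t := ⟨by
    rintro rfl
    simpa using P.interpolation 0 (Nat.zero_le _)⟩
  have ht0 : (0 : ℝ) < t := by exact_mod_cast Nat.pos_of_ne_zero ht.out
  set j₀ : Fin k := ⟨0, hk⟩ with hj₀
  -- Only `j₀` really measures. The other parties get the constant `t^{-1/2}`, so their operators
  -- are scalar and their outcomes carry no information.
  set β : Fin k → Fin t → ℂ := fun j i =>
    if j = j₀ then P.amplitude i else (((Real.sqrt t)⁻¹ : ℝ) : ℂ) with hβ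
  have hβsum (j) : ∑ i, ‖β j i‖ ^ 2 = 1 := by
    by_cases hj : j = j₀
    · simpa [hβ, hj] using P.sum_norm_sq_amplitude
    · simp [hβ, hj, ht0.ne', abs_of_pos (Real.sqrt_pos.2 ht0), inv_pow, Real.sq_sqrt ht0.le]
  have hβprod (i) : ∏ j, β j i = P.amplitude i * (((Real.sqrt t)⁻¹ : ℝ) : ℂ) ^ (k - 1) := by
    rw [← Finset.mul_prod_erase _ _ (Finset.mem_univ j₀),
      Finset.prod_congr rfl fun j hj => if_neg (Finset.ne_of_mem_erase hj), Finset.prod_const,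
      Finset.card_erase_of_mem (Finset.mem_univ _), Finset.card_univ, Fintype.card_fin]
    simp [hβ]
  set M : ∀ j, Fin t → Matrix (Fin t × (Fin n → ι j)) (Fin t × (Fin n → ι j)) ℂ := fun j a =>
    Matrix.diagonal fun p => β j (p.1 + a) with hM
  -- Of the `k` factors `t^{-1/2}`, `k - 1` come from the idle parties and one from the
  -- normalization of the GHZ state.
  set cst : ℂ := (((Real.sqrt t)⁻¹ : ℝ) : ℂ) ^ k * Real.sqrt P.successProb with hcst
  have hcst_norm : ‖cst‖ ^ 2 = ((t : ℝ) ^ k)⁻¹ * P.successProb := by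
    rw [hcst, norm_mul, norm_pow, mul_pow, Complex.norm_real, Complex.norm_real,
      Real.norm_eq_abs, Real.norm_eq_abs, sq_abs, Real.sq_sqrt P.successProb_pos.le, ← pow_mul,
      mul_comm k 2, pow_mul, sq_abs, inv_pow, Real.sq_sqrt ht0.le, inv_pow]
  have hstate (a : Fin k → Fin t) :
      tensorMatrix (P.localMap (Equiv.addRight (a j₀))) *ᵥ
        (tensorMatrix (fun j => M j (a j)) *ᵥ stateProd (ghz k t) (statePow n ψ)) =
      cst • statePow n φ := by
    have hmul : tensorMatrix (P.localMap (Equiv.addRight (a j₀))) *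
        tensorMatrix (fun j => M j (a j)) = tensorMatrix fun j => Matrix.of fun x p =>
          (P.γ j (p.1 + a j₀) * β j (p.1 + a j₀)) *
            powMatrix n ((A j).eval (P.z (p.1 + a j₀))) x p.2 := by
      rw [tensorMatrix_mul]
      congr 1
      ext j x p
      have hshift : β j (p.1 + a j) = β j (p.1 + a j₀) := by
        by_cases hj : j = j₀
        · subst hj; rfl
        · simp [hβ, hj]
      rw [hM, Matrix.mul_diagonal, hshift]
      simp only [localMap, Matrix.of_apply, Equiv.coe_addRight]
      ring
    rw [Matrix.mulVec_mulVec, hmul,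
      tensorMatrix_mulVec_stateProd_ghz hk (fun j i => P.γ j (i + a j₀) * β j (i + a j₀))
        (fun j i => powMatrix n ((A j).eval (P.z (i + a j₀))))]
    have hcoef (i) : ∏ j, (P.γ j i * β j i) =
        ((((Real.sqrt t)⁻¹ : ℝ) : ℂ) ^ (k - 1) * Real.sqrt P.successProb) * P.c i := by
      rw [Finset.prod_mul_distrib, hβprod, ← mul_assoc, P.prod_mul_amplitude]
      ring
    have hsum := Equiv.sum_comp (Equiv.addRight (a j₀)) fun i => (∏ j, P.γ j i * β j i) •
      ((tensorMatrix fun j => powMatrix n ((A j).eval (P.z i))) *ᵥ statePow n ψ)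
    simp only [Equiv.coe_addRight] at hsum
    rw [hsum]
    simp only [hcoef, tensorMatrix_powMatrix_mulVec_statePow, mul_smul, ← Finset.smul_sum]
    rw [P.sum_statePow hA, hcst, ← mul_pow_sub_one hk.ne', mul_smul, mul_smul]
  have hround (a : Fin k → Fin t) : LOCCReaches (statePow n φ)
      (tensorMatrix (fun j => M j (a j)) *ᵥ stateProd (ghz k t) (statePow n ψ)) (‖cst‖ ^ 2) := by
    have h := LOCCReaches.round (φ := statePow n φ)
      (tensorMatrix (fun j => M j (a j)) *ᵥ stateProd (ghz k t) (statePow n ψ))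
      (Ω := fun _ => Unit) (fun j _ => P.localMap (Equiv.addRight (a j₀)) j)
      (fun j => by
        simpa using posSemidef_one_sub_conjTranspose_mul_self _ (P.norm_localMap_le _ j))
      (fun _ => ‖cst‖ ^ 2) (fun _ => by
        rw [hstate a]
        exact LOCCReaches.accept cst)
    simpa using h
  have h := LOCCReaches.round (φ := statePow n φ) (stateProd (ghz k t) (statePow n ψ))
    (Ω := fun _ => Fin t) M (fun j => by
      have hone : ∑ a, (M j a)ᴴ * M j a = 1 := by
        simp only [hM, Matrix.diagonal_conjTranspose, Matrix.diagonal_mul_diagonal]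
        ext p q
        rw [Matrix.sum_apply]
        by_cases hpq : p = q
        · subst hpq
          have hs : ∑ a, ‖β j (p.1 + a)‖ ^ 2 = 1 := by
            rw [← hβsum j]
            exact Equiv.sum_comp (Equiv.addLeft p.1) fun i => ‖β j i‖ ^ 2
          simp only [Matrix.diagonal_apply_eq, Matrix.one_apply_eq, Pi.star_apply, RCLike.star_def,
            Complex.conj_mul']
          exact_mod_cast hs
        · simp [hpq]
      rw [hone, sub_self]
      exact Matrix.PosSemidef.zero)
    (fun _ => ‖cst‖ ^ 2) hround
  -- There are `t ^ k` outcomes, each succeeding with probability `t ^ (-k) * P.successProb`.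
  convert h using 1
  rw [Finset.sum_const, Finset.card_univ, Fintype.card_fun, Fintype.card_fin, Fintype.card_fin,
    nsmul_eq_mul, hcst_norm]
  push_cast
  rw [mul_inv_cancel_left₀ (by positivity)]

end LOCC

/-! ### Potentials of averages of uniform measures on circles -/

section Potential

open Real Metric

/-- The uniform probability measure on a circle. -/
def circleMeasure (c : ℂ) (ρ : ℝ) : Measure ℂ :=
  ENNReal.ofReal (2 * π)⁻¹ • (volume.restrict (Set.Ioc 0 (2 * π))).map (circleMap c ρ)

lemma measurable_circleMap (c : ℂ) (ρ : ℝ) : Measurable (circleMap c ρ) :=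
  (continuous_circleMap c ρ).measurable

instance (c : ℂ) (ρ : ℝ) : IsProbabilityMeasure (circleMeasure c ρ) := by
  constructor
  rw [circleMeasure, Measure.smul_apply, Measure.map_apply (measurable_circleMap c ρ) .univ]
  simp only [Set.preimage_univ, Measure.restrict_apply .univ, Set.univ_inter, volume_Ioc, sub_zero,
    smul_eq_mul]
  rw [← ENNReal.ofReal_mul (by positivity), inv_mul_cancel₀ two_pi_pos.ne', ENNReal.ofReal_one]

lemma integral_circleMeasure {f : ℂ → ℝ} (hf : Measurable f) (c : ℂ) (ρ : ℝ) :
    ∫ t, f t ∂circleMeasure c ρ = circleAverage f c ρ := by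
  rw [circleMeasure, integral_smul_measure, ENNReal.toReal_ofReal (by positivity),
    integral_map (measurable_circleMap c ρ).aemeasurable hf.aestronglyMeasurable, circleAverage,
    intervalIntegral.integral_of_le two_pi_pos.le]

lemma integrable_circleMeasure {f : ℂ → ℝ} (hf : Measurable f) {c : ℂ} {ρ : ℝ}
    (hfi : CircleIntegrable f c ρ) : Integrable f (circleMeasure c ρ) := by
  refine Integrable.smul_measure ?_ ENNReal.ofReal_ne_top
  rw [integrable_map_measure hf.aestronglyMeasurable (measurable_circleMap c ρ).aemeasurable]
  exact (intervalIntegrable_iff_integrableOn_Ioc_of_le two_pi_pos.le).1 hfi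

lemma circleMeasure_singleton (a c : ℂ) {ρ : ℝ} (hρ : ρ ≠ 0) : circleMeasure c ρ {a} = 0 := by
  rw [circleMeasure, Measure.smul_apply,
    Measure.map_apply (measurable_circleMap c ρ) (measurableSet_singleton a)]
  have h := ((Set.countable_singleton a).preimage_circleMap c hρ).measure_zero
    (volume.restrict (Set.Ioc 0 (2 * π)))
  rw [h, smul_zero]

lemma circleMeasure_compl_sphere (c : ℂ) {ρ : ℝ} (hρ : 0 ≤ ρ) :
    circleMeasure c ρ (sphere c ρ)ᶜ = 0 := by
  rw [circleMeasure, Measure.smul_apply, Measure.map_apply (measurable_circleMap c ρ)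
    isClosed_sphere.measurableSet.compl]
  have : circleMap c ρ ⁻¹' (sphere c ρ)ᶜ = ∅ := by
    ext θ
    simp [abs_of_nonneg hρ]
  simp [this]

lemma circleAverage_log_norm_sub_eq_log_max (a c : ℂ) {ρ : ℝ} (hρ : 0 < ρ) :
    circleAverage (fun t => log ‖t - a‖) c ρ = log (max ‖c - a‖ ρ) := by
  rw [circleAverage_log_norm_sub_const_eq_log_radius_add_posLog hρ.ne',
    posLog_eq_log_max_one (by positivity), ← log_mul hρ.ne' (by positivity),
    mul_max_of_nonneg _ _ hρ.le, mul_one, mul_inv_cancel_left₀ hρ.ne', max_comm]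

lemma elog2_ofReal {x : ℝ} (hx : 0 < x) :
    elog2 (ENNReal.ofReal x) = ((log x / log 2 : ℝ) : EReal) := by
  rw [elog2, ENNReal.log_ofReal_of_pos hx, EReal.coe_div]

/-- The extended and real logarithms differ only where `t = 0` or `t = z`, which are null;
integrability makes both parts finite. -/
lemma potential_eq_integral {σ : Measure ℂ} {z : ℂ} (h0 : σ {0} = 0) (hz : σ {z} = 0)
    (hint : Integrable (fun t => (log ‖t‖ - log ‖t - z‖) / log 2) σ) :
    potential σ z = ((∫ t, (log ‖t‖ - log ‖t - z‖) / log 2 ∂σ : ℝ) : EReal) := by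
  have hae : ∀ᵐ t ∂σ, elog2 (‖t‖ₑ / ‖z - t‖ₑ) =
      (((log ‖t‖ - log ‖t - z‖) / log 2 : ℝ) : EReal) := by
    filter_upwards [measure_eq_zero_iff_ae_notMem.1 h0, measure_eq_zero_iff_ae_notMem.1 hz]
      with t ht0 htz
    have ht : 0 < ‖t‖ := norm_pos_iff.2 ht0
    have hzt : 0 < ‖z - t‖ := norm_pos_iff.2 (sub_ne_zero.2 (Ne.symm htz))
    rw [← ofReal_norm, ← ofReal_norm, ← ENNReal.ofReal_div_of_pos hzt,
      elog2_ofReal (div_pos ht hzt), log_div ht.ne' hzt.ne', norm_sub_rev z t]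
  have hpos : ∫⁻ t, (elog2 (‖t‖ₑ / ‖z - t‖ₑ)).toENNReal ∂σ =
      ∫⁻ t, ENNReal.ofReal ((log ‖t‖ - log ‖t - z‖) / log 2) ∂σ := by
    refine lintegral_congr_ae (hae.mono fun t ht => ?_)
    simp only [ht, EReal.real_coe_toENNReal]
  have hneg : ∫⁻ t, (-elog2 (‖t‖ₑ / ‖z - t‖ₑ)).toENNReal ∂σ =
      ∫⁻ t, ENNReal.ofReal (-((log ‖t‖ - log ‖t - z‖) / log 2)) ∂σ := by
    refine lintegral_congr_ae (hae.mono fun t ht => ?_)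
    simp only [ht, ← EReal.coe_neg, EReal.real_coe_toENNReal]
  have hcoe {x : ℝ≥0∞} (hx : x ≠ ∞) : (x : EReal) = ((x.toReal : ℝ) : EReal) := by
    rw [← EReal.coe_toReal (x := (x : EReal)) (by simpa using hx) (by simp), EReal.toReal_coe_ennreal]
  have hneg_ne : ∫⁻ t, ENNReal.ofReal (-((log ‖t‖ - log ‖t - z‖) / log 2)) ∂σ ≠ ∞ :=
    hint.neg.lintegral_lt_top.ne
  rw [potential, hpos, hneg, integral_eq_lintegral_pos_part_sub_lintegral_neg_part hint,
    EReal.coe_sub, hcoe hint.lintegral_lt_top.ne, hcoe hneg_ne]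

/-- The average of the uniform measures on the circles of radius `ρ` about the given points. -/
def nodeMeasure {N : ℕ} (z : Fin N → ℂ) (ρ : ℝ) : Measure ℂ :=
  (N : ℝ≥0∞)⁻¹ • ∑ i, circleMeasure (z i) ρ

lemma isProbabilityMeasure_nodeMeasure {N : ℕ} (hN : N ≠ 0) (z : Fin N → ℂ) (ρ : ℝ) :
    IsProbabilityMeasure (nodeMeasure z ρ) := by
  constructor
  rw [nodeMeasure, Measure.smul_apply, Measure.finsetSum_apply]
  simp only [measure_univ, Finset.sum_const, Finset.card_univ, Fintype.card_fin, nsmul_eq_mul,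
    mul_one, smul_eq_mul]
  exact ENNReal.inv_mul_cancel (by simpa using hN) (by simp)

lemma support_nodeMeasure_subset {N : ℕ} (z : Fin N → ℂ) {ρ : ℝ} (hρ : 0 ≤ ρ) :
    (nodeMeasure z ρ).support ⊆ ⋃ i, sphere (z i) ρ := by
  refine Measure.support_subset_of_isClosed (isClosed_iUnion_of_finite fun _ => isClosed_sphere) ?_
  rw [mem_ae_iff, nodeMeasure, Measure.smul_apply, Measure.finsetSum_apply]
  refine (smul_eq_zero_of_right _ (Finset.sum_eq_zero fun i _ => ?_))
  refine measure_mono_null ?_ (circleMeasure_compl_sphere (z i) hρ)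
  exact Set.compl_subset_compl.2 (Set.subset_iUnion (fun i => sphere (z i) ρ) i)

/-- The average of `log |t - a|` over a circle is `log (max |c - a| ρ)`: smearing the point masses
truncates the logarithmic singularity. -/
lemma potential_nodeMeasure {N : ℕ} (hN : N ≠ 0) (z : Fin N → ℂ) {ρ : ℝ} (hρ : 0 < ρ) (a : ℂ) :
    potential (nodeMeasure z ρ) a =
      (((∑ i, (log (max ‖z i‖ ρ) - log (max ‖z i - a‖ ρ))) / (N * log 2) : ℝ) : EReal) := by
  have hsing (b : ℂ) : nodeMeasure z ρ {b} = 0 := by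
    rw [nodeMeasure, Measure.smul_apply, Measure.finsetSum_apply]
    exact smul_eq_zero_of_right _ (Finset.sum_eq_zero fun i _ => circleMeasure_singleton _ _ hρ.ne')
  have hmeas : Measurable fun t : ℂ => (log ‖t‖ - log ‖t - a‖) / log 2 := by
    have h (b : ℂ) : Measurable fun t : ℂ => log ‖t - b‖ :=
      measurable_log.comp (by fun_prop)
    simpa using (((h 0).sub (h a)).div_const (log 2))
  have hci0 (c : ℂ) : CircleIntegrable (fun t => log ‖t‖) c ρ := by
    simpa using circleIntegrable_log_norm_sub_const (a := 0) (c := c) ρ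
  have hci1 (c : ℂ) : CircleIntegrable (fun t => log ‖t - a‖) c ρ :=
    circleIntegrable_log_norm_sub_const ρ
  have hci (c : ℂ) : CircleIntegrable (fun t => (log ‖t‖ - log ‖t - a‖) / log 2) c ρ := by
    simp only [div_eq_inv_mul]
    exact ((hci0 c).sub (hci1 c)).const_smul (a := (log 2)⁻¹)
  have hint (i : Fin N) : Integrable (fun t => (log ‖t‖ - log ‖t - a‖) / log 2)
      (circleMeasure (z i) ρ) := integrable_circleMeasure hmeas (hci _)
  rw [potential_eq_integral (hsing 0) (hsing a)]
  · congr 1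
    rw [nodeMeasure, integral_smul_measure, integral_finsetSum_measure fun i _ => hint i]
    have hterm (i : Fin N) : ∫ t, (log ‖t‖ - log ‖t - a‖) / log 2 ∂circleMeasure (z i) ρ =
        (log (max ‖z i‖ ρ) - log (max ‖z i - a‖ ρ)) / log 2 := by
      rw [integral_circleMeasure hmeas]
      have h1 : circleAverage (fun t => (log 2)⁻¹ • (log ‖t‖ - log ‖t - a‖)) (z i) ρ =
          (log 2)⁻¹ • circleAverage (fun t => log ‖t‖ - log ‖t - a‖) (z i) ρ :=
        circleAverage_fun_smul
      have h2 : circleAverage (fun t => log ‖t‖) (z i) ρ = log (max ‖z i‖ ρ) := by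
        simpa using circleAverage_log_norm_sub_eq_log_max 0 (z i) hρ
      rw [circleAverage_fun_sub (hci0 _) (hci1 _), h2,
        circleAverage_log_norm_sub_eq_log_max a (z i) hρ] at h1
      simpa [div_eq_inv_mul] using h1
    simp only [hterm, ← Finset.sum_div, ENNReal.toReal_inv, ENNReal.toReal_natCast, smul_eq_mul]
    field_simp
  · exact Integrable.smul_measure (integrable_finsetSum_measure.2 fun i _ => hint i)
      (by simpa using hN)

end Potential

/-! ### The single-letter formula -/

section Formula

open Real Metric

/-- The truncated kernel `max (|y - t| - ρ) ρ` has nearly the same logarithmic average over the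
circle as `|y - t|`. -/
lemma eventually_le_circleAverage_log_max {R : ℝ} (hR : 0 < R) {η : ℝ} (hη : 0 < η) :
    ∀ᶠ m : ℕ in atTop, ∀ t : ℂ, ‖t‖ = R → log R - η ≤ circleAverage
      (fun y => log (max (‖y - t‖ - 1 / ((m : ℝ) + 1)) (1 / ((m : ℝ) + 1)))) 0 R := by
  have hδ (m : ℕ) : 0 < 1 / ((m : ℝ) + 1) := by positivity
  have hδ1 (m : ℕ) : 1 / ((m : ℝ) + 1) ≤ 1 := by
    rw [div_le_one (by positivity)]; linarith [m.cast_nonneg (α := ℝ)]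
  -- It suffices to treat `t = R`, by rotation. The constant `1 / 2` works because `max (s - δ) δ ≥
  -- s / 2`.
  have hlim := tendsto_circleAverage_log (a := 0) (R := R) (f := fun y => ‖y - R‖)
    (w := fun m y => max (‖y - R‖ - 1 / ((m : ℝ) + 1)) (1 / ((m : ℝ) + 1))) (c := 1 / 2)
    (C := 2 * R + 1) hR.ne' (by norm_num) (circleIntegrable_log_norm_sub_const R)
    (fun z _ => norm_nonneg _) (Set.countable_singleton (R : ℂ))
    (fun z _ hz => (norm_pos_iff.2 (sub_ne_zero.2 hz)).ne') (fun m => by fun_prop)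
    (fun m z _ => by
      rw [le_max_iff]
      by_contra! h
      linarith)
    (fun m z hz => by
      have h1 : ‖z - R‖ ≤ R + R := by
        refine (norm_sub_le _ _).trans ?_
        have hz' : ‖z‖ = R := by simpa [abs_of_pos hR] using hz
        rw [hz', Complex.norm_real, norm_eq_abs, abs_of_pos hR]
      exact max_le (by linarith [hδ m]) (by linarith [hδ1 m]))
    (fun z _ => by
      have h := tendsto_one_div_add_atTop_nhds_zero_nat (𝕜 := ℝ)
      simpa using (tendsto_const_nhds (x := ‖z - R‖)).sub h |>.max h)
  rw [circleAverage_log_norm_sub_const_of_mem_closedBall (by simp [abs_of_pos hR])] at hlim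
  filter_upwards [hlim.eventually (lt_mem_nhds (sub_lt_self _ hη))] with m hm t ht
  rw [circleAverage_norm_sub_eq_of_norm_eq
    (fun s => log (max (s - 1 / ((m : ℝ) + 1)) (1 / ((m : ℝ) + 1)))) ht]
  exact hm.le

variable {k : ℕ} {ι κ : Fin k → Type}
variable [∀ j, Fintype (ι j)] [∀ j, DecidableEq (ι j)] [∀ j, Fintype (κ j)]
variable {A : ∀ j, LaurentMap (κ j) (ι j)} {ψ : State ι} {φ : State κ} {e : ℕ}

/-- Nodes on the circle of radius `R` and a radius `ρ` for which the average of the uniform measures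
on the circles of radius `ρ` about the nodes nearly attains the circle average. -/
lemma IsDegeneration.exists_nodes_formula (hA : IsDegeneration A ψ φ e) {R : ℝ} (hR : 0 < R)
    {ε : ℝ} (hε : 0 < ε) : ∃ (N : ℕ) (z : Fin N → ℂ) (ρ : ℝ), N ≠ 0 ∧ 0 < ρ ∧ ρ < R ∧
      (∀ i, ‖z i‖ = R) ∧ ∀ i, ∀ a ∈ sphere (z i) ρ, ∃ w, normA A a ≤ w ∧ 0 < w ∧
        log w + e * ((∑ j, (log R - log (max ‖z j - a‖ ρ))) / N) ≤
          circleAverage (fun z => log (normA A z)) 0 R + ε := by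
  -- The share `e * ε'` pays for truncating the kernel; the other three pay for `δ`, for the
  -- variation of `log w` within distance `ρ`, and for the diagonal term.
  set ε' := ε / (e + 3) with hε'
  have hε'0 : 0 < ε' := by positivity
  obtain ⟨δ, hδ, hL⟩ := hA.exists_circleAverage_log_regNorm_lt hR hε'0
  set w := regNorm A δ with hw
  set L := circleAverage (fun z => log (w z)) 0 R with hLdef
  have hw0 (z) : 0 < w z := regNorm_pos A hδ z
  have habs : |R| = R := abs_of_pos hR
  have hsub : sphere (0 : ℂ) R ⊆ {0}ᶜ := by
    simpa [habs] using sphere_subset_compl_zero hR.ne'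
  have hwc := continuousOn_regNorm A δ
  have hunif := (isCompact_sphere (0 : ℂ) R).uniformContinuousAt_of_continuousAt
    (fun z => log (w z)) (fun z hz => (hwc.continuousAt
      (isOpen_compl_singleton.mem_nhds (hsub hz))).log (hw0 z).ne') (dist_mem_uniformity hε'0)
  obtain ⟨ρ₁, hρ₁, hunif⟩ := Metric.mem_uniformity_dist.1 hunif
  have hsmall := (tendsto_one_div_add_atTop_nhds_zero_nat (𝕜 := ℝ)).eventually
    (gt_mem_nhds (lt_min hρ₁ hR))
  obtain ⟨m, hm1, hm2⟩ := (hsmall.and (eventually_le_circleAverage_log_max hR hε'0)).exists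
  set ρ : ℝ := 1 / ((m : ℝ) + 1) with hρdef
  have hρ : 0 < ρ := by positivity
  obtain ⟨hρρ₁, hρR⟩ := lt_min_iff.1 hm1
  -- The self-interaction of a node, absent from the extremal problem, is spread over `N` nodes.
  obtain ⟨N, hN⟩ := exists_nat_gt (max 0 (e * (log R - log ρ) / ε'))
  obtain ⟨hN0, hNε⟩ := max_lt_iff.1 hN
  have hNne : N ≠ 0 := by rintro rfl; simp at hN0
  have hNε' : e * (log R - log ρ) ≤ N * ε' := ((div_lt_iff₀ hε'0).1 hNε).le
  -- Subtracting `ρ` makes extremality at `z i` usable on the whole circle of radius `ρ` about it,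
  -- since `|a - z j| ≥ |z i - z j| - ρ` there.
  set D : ℂ → ℂ → ℝ := fun a b => max (‖a - b‖ - ρ) ρ with hD
  have hDpos (a b) : 0 < D a b := lt_max_of_lt_right hρ
  have hDc (t : ℂ) : Continuous fun y => D y t := by simp only [hD]; fun_prop
  have hDint (t : ℂ) : CircleIntegrable (fun y => log (D y t)) 0 R :=
    ((hDc t).log fun y => (hDpos y t).ne').continuousOn.circleIntegrable hR.le
  obtain ⟨z, hz, -, hzi⟩ := exists_nodes_circle hR N (K := fun a b => D a b ^ e) (w := w)
    (κ := e * (log R - ε')) (by simp only [hD]; fun_prop)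
    (fun a _ b _ => by simp only [hD, norm_sub_rev a b])
    (fun a b => (pow_pos (hDpos a b) e).le) (fun a _ b _ _ => pow_pos (hDpos a b) e)
    (fun t _ => by
      simp only [log_pow]
      exact (hDint t).const_smul (a := (e : ℝ)))
    (fun t ht => by
      simp only [log_pow]
      have := circleAverage_fun_smul (a := (e : ℝ)) (f := fun y => log (D y t)) (c := 0) (R := R)
      simp only [smul_eq_mul] at this
      rw [this]
      exact mul_le_mul_of_nonneg_left (hm2 t (by simpa using ht)) e.cast_nonneg)
    (hwc.mono hsub) (fun z _ => hw0 z) N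
  refine ⟨N, z, ρ, hNne, hρ, hρR, hz, fun i a ha => ⟨w a, ?_, hw0 a, ?_⟩⟩
  · rw [normA_eq_regNorm_zero]
    exact regNorm_mono A le_rfl hδ.le a
  have hlogw : log (w a) ≤ log (w (z i)) + ε' := by
    have h := hunif (a := z i) (b := a) (by rw [dist_comm, mem_sphere.1 ha]; exact hρρ₁)
      (by simpa using hz i)
    have h' : dist (log (w (z i))) (log (w a)) < ε' := h
    rw [dist_eq, abs_lt] at h'
    linarith [h'.1]
  have hDle (j) : log (D (z i) (z j)) ≤ log (max ‖z j - a‖ ρ) := by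
    refine log_le_log (hDpos _ _) (max_le_max_right _ ?_)
    have h1 : ‖z i - z j‖ ≤ ‖a - z i‖ + ‖z j - a‖ := by
      rw [norm_sub_rev a, norm_sub_rev (z j)]
      exact norm_sub_le_norm_sub_add_norm_sub _ _ _
    rw [← dist_eq_norm a, mem_sphere.1 ha] at h1
    linarith
  have hDii : D (z i) (z i) = ρ := by simp [hD, hρ.le]
  have hsum1 : ∑ j, (log R - log (max ‖z j - a‖ ρ)) ≤
      N * log R - (log ρ + ∑ j ∈ Finset.univ.erase i, log (D (z i) (z j))) := by
    rw [Finset.sum_sub_distrib, Finset.sum_const, Finset.card_univ, Fintype.card_fin, nsmul_eq_mul]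
    refine sub_le_sub_left ?_ _
    calc log ρ + ∑ j ∈ Finset.univ.erase i, log (D (z i) (z j)) = ∑ j, log (D (z i) (z j)) := by
          rw [← Finset.add_sum_erase _ _ (Finset.mem_univ i), hDii]
      _ ≤ _ := Finset.sum_le_sum fun j _ => hDle j
  have hzi' := hzi i
  simp only [log_pow, ← Finset.mul_sum] at hzi'
  set S := ∑ j ∈ Finset.univ.erase i, log (D (z i) (z j)) with hS
  have he0 : (0 : ℝ) ≤ e := e.cast_nonneg
  have hN1 : (1 : ℝ) ≤ N := by exact_mod_cast Nat.one_le_iff_ne_zero.2 hNne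
  have hmain : N * log (w (z i)) + e * (N * log R - (log ρ + S)) ≤ N * (L + e * ε' + ε') := by
    have h1 : 0 ≤ e * ε' := by positivity
    linarith
  have hdiv : e * ((∑ j, (log R - log (max ‖z j - a‖ ρ))) / N) ≤
      L + e * ε' + ε' - log (w (z i)) := by
    rw [← mul_div_assoc, div_le_iff₀ hN0]
    have := mul_le_mul_of_nonneg_left hsum1 he0
    linarith
  have hεsum : ε = e * ε' + 3 * ε' := by
    rw [hε']
    field_simp
  linarith

lemma elog2_le_of_le {x w : ℝ} (hxw : x ≤ w) (hw : 0 < w) :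
    elog2 (ENNReal.ofReal x) ≤ ((log w / log 2 : ℝ) : EReal) := by
  rw [← elog2_ofReal hw]
  exact EReal.div_le_div_right_of_nonneg (by exact_mod_cast (log_pos one_lt_two).le)
    (ENNReal.log_monotone (ENNReal.ofReal_le_ofReal hxw))

/-- The witness is `nodeMeasure`: `ρ < R` keeps `0` out of its support, and its finite potential
avoids the exceptional value of `objective`. -/
theorem IsDegeneration.exponentFormula_le (hA : IsDegeneration A ψ φ e) {R : ℝ} (hR : 0 < R) :
    exponentFormula A e ≤
      ((2 * (circleAverage (fun z => log (normA A z)) 0 R / log 2) : ℝ) : EReal) := by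
  set L := circleAverage (fun z => log (normA A z)) 0 R with hL
  have hlog2 := log_pos one_lt_two
  rw [exponentFormula, EReal.coe_mul]
  refine mul_le_mul_of_nonneg_left ?_ (by norm_num)
  refine EReal.le_of_forall_lt_iff_le.1 fun x hx => ?_
  have hx' : L < x * log 2 := (div_lt_iff₀ hlog2).1 (EReal.coe_lt_coe_iff.1 hx)
  obtain ⟨N, z, ρ, hN, hρ, hρR, hz, hza⟩ := hA.exists_nodes_formula hR (sub_pos.2 hx')
  have hprob := isProbabilityMeasure_nodeMeasure hN z ρ
  have hsupp := support_nodeMeasure_subset z hρ.le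
  have h0 : (0 : ℂ) ∉ (nodeMeasure z ρ).support := by
    intro h
    obtain ⟨i, hi⟩ := Set.mem_iUnion.1 (hsupp h)
    have : R = ρ := by simpa [hz] using hi
    linarith
  refine iInf_le_of_le ⟨⟨nodeMeasure z ρ, hprob⟩, h0⟩ (iSup₂_le fun a ha => ?_)
  obtain ⟨i, hi⟩ := Set.mem_iUnion.1 (hsupp ha)
  obtain ⟨w, hAw, hw, hle⟩ := hza i a hi
  have hmax (i) : max ‖z i‖ ρ = R := by rw [hz, max_eq_left hρR.le]
  have hpot := potential_nodeMeasure hN z hρ a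
  simp only [hmax] at hpot
  simp only [ProbabilityMeasure.coe_mk]
  rw [objective, hpot, if_neg (EReal.coe_ne_top _)]
  have hcoe : (e : EReal) = ((e : ℝ) : EReal) := rfl
  rw [hcoe, ← EReal.coe_mul]
  refine (add_le_add_left (elog2_le_of_le hAw hw) _).trans ?_
  rw [← EReal.coe_add, EReal.coe_le_coe_iff]
  have hN0 : (N : ℝ) ≠ 0 := by exact_mod_cast hN
  have : log w / log 2 + e * ((∑ i, (log R - log (max ‖z i - a‖ ρ))) / (N * log 2)) =
      (log w + e * ((∑ i, (log R - log (max ‖z i - a‖ ρ))) / N)) / log 2 := by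
    field_simp
  rw [this, div_le_iff₀ hlog2]
  linarith

end Formula

/-! ### Achievable exponents -/

section Achievability

open Real

variable {k : ℕ} {ι κ : Fin k → Type}
variable [∀ j, Fintype (ι j)] [∀ j, DecidableEq (ι j)] [∀ j, Fintype (κ j)]
variable {A : ∀ j, LaurentMap (κ j) (ι j)} {ψ : State ι} {φ : State κ} {e : ℕ}

lemma circleAverage_logNormA (A : ∀ j, LaurentMap (κ j) (ι j)) (R : ℝ) :
    circleAverage (logNormA A) 0 R = circleAverage (fun z => log (normA A z)) 0 R / log 2 := by
  have h := circleAverage_fun_smul (a := (log 2)⁻¹) (f := fun z => log (normA A z)) (c := 0)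
    (R := R)
  simp only [smul_eq_mul, ← div_eq_inv_mul] at h
  exact h

lemma IsDegeneration.circleIntegrable_logNormA (hA : IsDegeneration A ψ φ e) {R : ℝ}
    (hR : 0 < R) : CircleIntegrable (logNormA A) 0 R := by
  have h := (hA.circleIntegrable_log_normA hR.ne').const_smul (a := (log 2)⁻¹)
  refine (congrArg (CircleIntegrable · 0 R) (funext fun z => ?_)).mp h
  simp only [Pi.smul_apply, smul_eq_mul, logNormA, logb, div_eq_inv_mul]

lemma IsDegeneration.circleAverage_logNormA_nonneg (hA : IsDegeneration A ψ φ e) {R : ℝ}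
    (hR : 0 < R) : 0 ≤ circleAverage (logNormA A) 0 R := by
  rw [circleAverage_logNormA]
  exact div_nonneg (hA.circleAverage_log_normA_nonneg hR) (log_pos one_lt_two).le

variable [∀ j, DecidableEq (κ j)]

/-- A number that is approximated from above by twice the circle averages is the exponent of some
protocols, and these are LOCC transformations. -/
lemma IsDegeneration.isAchievableExponent (hk : 0 < k) (hA : IsDegeneration A ψ φ e) {r : ℝ}
    (hr0 : 0 ≤ r)
    (hr : ∀ ε : ℝ, 0 < ε → ∃ R : ℝ, 0 < R ∧ 2 * circleAverage (logNormA A) 0 R < r + ε) :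
    IsAchievableExponent A e r ∧ IsLOCCAchievableExponent ψ φ r := by
  obtain ⟨P, hP⟩ := exists_protocols_hasExponent (A := A) (e := e) (r := r) hk fun ε hε n => by
    obtain ⟨R, hR, hRε⟩ := hr ε hε
    have hlog2 := log_pos one_lt_two
    rw [circleAverage_logNormA, ← mul_div_assoc, div_lt_iff₀ hlog2] at hRε
    -- Half of the gap, because the exponent contains twice the average.
    obtain ⟨δ, hδ, hL⟩ := hA.exists_circleAverage_log_regNorm_lt hR
      (half_pos (sub_pos.2 hRε))
    obtain ⟨P, hP⟩ := exists_protocol A e n hR hδ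
    refine ⟨P, le_trans ?_ hP⟩
    rw [rpow_def_of_pos two_pos]
    gcongr
    have h1 : 2 * circleAverage (fun z => log (regNorm A δ z)) 0 R ≤ (r + ε) * log 2 := by
      linarith
    have h2 := mul_le_mul_of_nonneg_left h1 n.cast_nonneg (α := ℝ)
    linarith
  exact ⟨⟨hr0, _, subexponential_mul_add_one e, P, hP⟩,
    hr0, _, subexponential_mul_add_one e, _,
    fun n => ⟨(P n).successProb_pos, (P n).loccReaches hk hA⟩, hP⟩

end Achievability

end Degeneration

end

theorem mainTheorem4 {k : ℕ} (hk : 0 < k) {ι κ : Fin k → Type}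
    [∀ j, Fintype (ι j)] [∀ j, DecidableEq (ι j)]
    [∀ j, Fintype (κ j)] [∀ j, DecidableEq (κ j)]
    (A : ∀ j, Degeneration.LaurentMap (κ j) (ι j))
    (ψ : Degeneration.State ι) (φ : Degeneration.State κ) (e : ℕ)
    (hA : Degeneration.IsDegeneration A ψ φ e) :
    (∀ R : ℝ, 0 < R →
      CircleIntegrable (Degeneration.logNormA A) 0 R ∧
      Degeneration.optimalExponent A e ≤
        2 * Real.circleAverage (Degeneration.logNormA A) 0 R ∧
      Degeneration.exponentFormula A e ≤
        ((2 * Real.circleAverage (Degeneration.logNormA A) 0 R : ℝ) : EReal)) ∧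
    ∃ r : ℝ,
      IsGLB {x : ℝ | ∃ R : ℝ, 0 < R ∧
        x = 2 * Real.circleAverage (Degeneration.logNormA A) 0 R} r ∧
      Degeneration.IsAchievableExponent A e r ∧
      Degeneration.IsLOCCAchievableExponent ψ φ r := by
  have hnonneg (R : ℝ) (hR : 0 < R) :
      0 ≤ 2 * Real.circleAverage (Degeneration.logNormA A) 0 R :=
    mul_nonneg two_pos.le (hA.circleAverage_logNormA_nonneg hR)
  refine ⟨fun R hR => ⟨hA.circleIntegrable_logNormA hR, ?_, ?_⟩, ?_⟩
  · exact csInf_le ⟨0, fun r hr => hr.1⟩ (hA.isAchievableExponent hk (hnonneg R hR)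
      fun ε hε => ⟨R, hR, lt_add_of_pos_right _ hε⟩).1
  · rw [Degeneration.circleAverage_logNormA]
    exact hA.exponentFormula_le hR
  · set S := {x : ℝ | ∃ R : ℝ, 0 < R ∧
      x = 2 * Real.circleAverage (Degeneration.logNormA A) 0 R} with hS
    have hlow : 0 ∈ lowerBounds S := by
      rintro x ⟨R, hR, rfl⟩
      exact hnonneg R hR
    have hne : S.Nonempty := ⟨_, 1, one_pos, rfl⟩
    have hglb : IsGLB S (sInf S) := isGLB_csInf hne ⟨0, hlow⟩
    -- The infimum is not assumed to be attained: for each `ε` some radius comes close enough.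
    refine ⟨sInf S, hglb, hA.isAchievableExponent hk (hglb.2 hlow) fun ε hε => ?_⟩
    obtain ⟨x, ⟨R, hR, rfl⟩, hx⟩ := exists_lt_of_csInf_lt hne (lt_add_of_pos_right _ hε)
    exact ⟨R, hR, hx⟩
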